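/- Let $K$ be an infinite field, let $n,l\ge 1$ be integers, and let $S=K[x_1,\dots,x_n]$. Let $\lambda=(\lambda_1\ge\lambda_2\ge\cdots)$ be a partition of $n+l-1$ with $\lambda_1\ge l$. For a partition $\rho$ of $n+l-1$ with $\rho_1\ge l$, let $\mathrm{Tab}(l,\rho)$ be the set of fillings of the boxes of the Young diagram of $\rho$ by the multiset $\{1,\dots,1,2,\dots,n\}$, in which $1$ occurs $l$ times and each of $2,\dots,n$ occurs once, such that no two copies of $1$ lie in the same column. For $T\in\mathrm{Tab}(l,\rho)$ let $$f_T=\prod_{j=1}^{\rho_1}\ \prod_{i<i'}\bigl(x_{T(i,j)}-x_{T(i',j)}\bigr)\in S$$ be its Specht polynomial, where $T(i,j)$ is the entry of $T$ in row $i$ and column $j$, and the inner product is over all pairs of rows $i<i'$ meeting column $j$. Let $I_{l,\lambda}\subset S$ be the ideal generated by the $f_T$ with $T\in\mathrm{Tab}(l,\lambda)$. Write $\rho\unlhd\lambda$ for the dominance order, i.e. $\rho_1+\cdots+\rho_k\le\lambda_1+\cdots+\lambda_k$ for all $k$. Then, with respect to any monomial order on $S$ for which $x_1$ is either the smallest or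 the largest of the variables $x_1,\dots,x_n$, the set $$\{\,f_T \mid T\in\mathrm{Tab}(l,\rho),\ \rho \text{ a partition of } n+l-1 \text{ with } \rho_1\ge l \text{ and } \rho\unlhd\lambda\,\}$$ is a Gröbner basis of $I_{l,\lambda}$; that is, it is a finite set of nonzero elements of $I_{l,\lambda}$ whose initial monomials generate the ideal generated by the initial monomials of all nonzero elements of $I_{l,\lambda}$. -/

import Mathlib

open scoped MonomialOrder

noncomputable section

/-- The set of partitions of `n + l - 1` whose largest part is at least `l`. A partition is
represented by its Young diagram: `μ.rowLen i` is the `(i+1)`-st part, `μ.card` the sum of the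
parts. -/
def partitionsGE (n l : ℕ) : Set YoungDiagram :=
  {μ | μ.card + 1 = n + l ∧ l ≤ μ.rowLen 0}

/-- `Dominates μ ρ` is `ρ ⊴ μ` in the dominance order (used for partitions of the same integer):
every partial sum of the parts of `ρ` is at most the corresponding partial sum for `μ`. -/
def Dominates (μ ρ : YoungDiagram) : Prop :=
  ∀ k : ℕ, ∑ i ∈ Finset.range k, ρ.rowLen i ≤ ∑ i ∈ Finset.range k, μ.rowLen i

/-- The set `Tab(l, μ)`: fillings of the cells `(row, column)` of the Young diagram `μ` by the
multiset `{1, …, 1, 2, …, n}` with `l` copies of `1`, such that no two copies of `1` are in the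
same column. The number `i + 1` is represented by `i : Fin n`; in particular `0 : Fin n` stands
for the number `1`. -/
structure LTableau (n l : ℕ) [NeZero n] (μ : YoungDiagram) where
  /-- the entry in a cell -/
  entry : {c : ℕ × ℕ // c ∈ μ.cells} → Fin n
  /-- the smallest number is used exactly `l` times -/
  card_zero : (Finset.univ.filter fun c => entry c = 0).card = l
  /-- every other number is used exactly once -/
  card_ne_zero : ∀ i : Fin n, i ≠ 0 → (Finset.univ.filter fun c => entry c = i).card = 1
  /-- no two copies of the smallest number share a column -/
  col_zero : ∀ c d, entry c = 0 → entry d = 0 → c.1.2 = d.1.2 → c = d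

/-- The difference product of the `j`-th column of `T`, read from top to bottom. -/
def LTableau.columnDelta (K : Type*) [Field K] {n l : ℕ} [NeZero n] {μ : YoungDiagram}
    (T : LTableau n l μ) (j : ℕ) : MvPolynomial (Fin n) K :=
  ∏ p : {c : ℕ × ℕ // c ∈ μ.cells} × {c : ℕ × ℕ // c ∈ μ.cells} with
      p.1.1.2 = j ∧ p.2.1.2 = j ∧ p.1.1.1 < p.2.1.1,
    (MvPolynomial.X (T.entry p.1) - MvPolynomial.X (T.entry p.2))

/-- The Specht polynomial `f_T`: the product of the difference products of all columns. -/
def LTableau.spechtPoly (K : Type*) [Field K] {n l : ℕ} [NeZero n] {μ : YoungDiagram}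
    (T : LTableau n l μ) : MvPolynomial (Fin n) K :=
  ∏ j ∈ Finset.range (μ.rowLen 0), T.columnDelta K j

/-- The ideal `I_{l, μ}` generated by all Specht polynomials `f_T`, `T ∈ Tab(l, μ)`. -/
def spechtIdeal (K : Type*) [Field K] (n l : ℕ) [NeZero n] (μ : YoungDiagram) :
    Ideal (MvPolynomial (Fin n) K) :=
  Ideal.span (Set.range fun T : LTableau n l μ => T.spechtPoly K)

/-- The ideal generated by the initial monomials, with respect to `m`, of the nonzero elements
of `A`. -/
def initialIdeal {σ K : Type*} [Field K] (m : MonomialOrder σ) (A : Set (MvPolynomial σ K)) :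
    Ideal (MvPolynomial σ K) :=
  Ideal.span ((fun f => MvPolynomial.monomial (m.degree f) (1 : K)) '' {f | f ∈ A ∧ f ≠ 0})

/-- `G` is a Gröbner basis of the ideal `I` with respect to the monomial order `m`: a finite set
of nonzero elements of `I` whose initial monomials generate the initial ideal of `I`. -/
structure IsGroebnerBasis {σ K : Type*} [Field K] (m : MonomialOrder σ)
    (G : Set (MvPolynomial σ K)) (I : Ideal (MvPolynomial σ K)) : Prop where
  finite : G.Finite
  ne_zero : ∀ g ∈ G, g ≠ 0
  subset : ∀ g ∈ G, g ∈ I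
  initial_eq : initialIdeal m (I : Set (MvPolynomial σ K)) = initialIdeal m G

/-- The variable `x_i` is the smallest among the variables with respect to `m`. -/
def IsSmallestVar {σ : Type*} (m : MonomialOrder σ) (i : σ) : Prop :=
  ∀ j : σ, Finsupp.single i 1 ≼[m] Finsupp.single j 1

/-- The variable `x_i` is the largest among the variables with respect to `m`. -/
def IsLargestVar {σ : Type*} (m : MonomialOrder σ) (i : σ) : Prop :=
  ∀ j : σ, Finsupp.single j 1 ≼[m] Finsupp.single i 1

end

noncomputable section

open MvPolynomial Finset

/-! Two facts carry the theorem. The first is membership: if `ρ ⊴ μ`, the Specht ideal of `ρ` lies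
in that of `μ`. Dominance is generated by moving one box to a higher row, and Lagrange interpolation
writes the product of two column Vandermondes as a combination of products with one variable moved
from the longer column to the shorter one (`diffProd_mul_mem_span`, `spechtIdeal_le_of_dominates`).

The second concerns initial monomials. By division with remainder it suffices that every nonzero `f`
in the ideal has some monomial, not necessarily the leading one, divisible by the leading monomial
of some `f_T` with `T` of shape `ρ ⊴ μ` (`isGroebnerBasis_of_exists_mem_support`). Induction on the
variables produces together a monomial `u`, a point `a` where the polynomial does not vanish, and a
lattice word `r ≤ u` whose shape lists the multiplicities of the coordinates of `a`
(`exists_latticeWord_eval_ne_zero`). Each letter is a box; putting its variable there gives a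
tableau in which the leading exponent of a variable is at most its row index, hence at most its
exponent in `u`. Since `f` does not vanish at `a`, some generator does not either, so `a` separates
the entries of each of its columns, and the pigeonhole principle bounds the multiplicities by
partial sums of `μ`.

The repeated variable is treated separately. If it is smallest, it is frozen at a value counted `l`
times, and its copies form an initial row of length `l`. If it is largest, its copies are added at
the end as a horizontal strip (`exists_horizontalStrip`). The leading exponent this costs is a sum
of defects, and it is available because `f`, restricted to a line, is divisible by the corresponding
powers of linear forms (`pow_dvd_evalExceptZero`). -/

/-- The difference product of a finite set of variables. -/
def diffProd (K : Type*) [Field K] {n : ℕ} (C : Finset (Fin n)) : MvPolynomial (Fin n) K :=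
  ∏ p ∈ C ×ˢ C with p.1 < p.2, (X p.1 - X p.2)

/-- `C j` is the set of entries of the `j`-th column of a tableau in `Tab(l, ρ)`. -/
structure IsColumnFamily {n : ℕ} [NeZero n] (l : ℕ) (ρ : YoungDiagram)
    (C : ℕ → Finset (Fin n)) : Prop where
  card_eq : ∀ j, (C j).card = ρ.colLen j
  card_zero : #{j ∈ range (ρ.rowLen 0) | 0 ∈ C j} = l
  card_ne_zero : ∀ k : Fin n, k ≠ 0 → #{j ∈ range (ρ.rowLen 0) | k ∈ C j} = 1

/-- The product of the difference products of all columns. -/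
def columnsPoly (K : Type*) [Field K] {n : ℕ} (ρ : YoungDiagram) (C : ℕ → Finset (Fin n)) :
    MvPolynomial (Fin n) K :=
  ∏ j ∈ range (ρ.rowLen 0), diffProd K (C j)

/-! ### Difference products up to sign. -/

section Associates

variable {K : Type*} [Field K] {n : ℕ}

theorem associated_X_sub_X_comm (i j : Fin n) :
    Associated (X i - X j : MvPolynomial (Fin n) K) (X j - X i) := by
  rw [← neg_sub]
  exact (Associated.refl _).neg_left

/-- The difference product does not depend, up to sign, on the order of the variables. -/
theorem associated_prod_diffProd {ι α : Type*} [LinearOrder α] (s : Finset ι) (h : ι → α)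
    (hh : Set.InjOn h s) (g : ι → Fin n) (hg : Set.InjOn g s) :
    Associated (∏ p ∈ s ×ˢ s with h p.1 < h p.2, (X (g p.1) - X (g p.2) : MvPolynomial (Fin n) K))
      (diffProd K (s.image g)) := by
  classical
  let φ : ι × ι → Fin n × Fin n := fun p =>
    if g p.1 < g p.2 then (g p.1, g p.2) else (g p.2, g p.1)
  have key : ∏ p ∈ s ×ˢ s with h p.1 < h p.2,
      (X (φ p).1 - X (φ p).2 : MvPolynomial (Fin n) K) = diffProd K (s.image g) := by
    refine Finset.prod_bij (fun p _ => φ p) ?_ ?_ ?_ (fun _ _ => rfl)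
    · rintro ⟨x, y⟩ hp
      simp only [mem_filter, mem_product] at hp
      obtain ⟨⟨hx, hy⟩, hxy⟩ := hp
      have hne : g x ≠ g y := fun e => hxy.ne (congrArg h (hg hx hy e))
      simp only [mem_filter, mem_product, φ]
      split_ifs with hlt
      · exact ⟨⟨mem_image_of_mem _ hx, mem_image_of_mem _ hy⟩, hlt⟩
      · exact ⟨⟨mem_image_of_mem _ hy, mem_image_of_mem _ hx⟩,
          lt_of_le_of_ne (not_lt.mp hlt) hne.symm⟩
    · rintro ⟨x, y⟩ hp ⟨x', y'⟩ hp' e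
      simp only [mem_filter, mem_product] at hp hp'
      obtain ⟨⟨hx, hy⟩, hxy⟩ := hp
      obtain ⟨⟨hx', hy'⟩, hxy'⟩ := hp'
      simp only [φ] at e
      split_ifs at e <;> simp only [Prod.mk.injEq] at e ⊢
      · exact ⟨hg hx hx' e.1, hg hy hy' e.2⟩
      · have h1 := hg hx hy' e.1
        have h2 := hg hy hx' e.2
        subst h1 h2
        exact absurd hxy hxy'.not_gt
      · have h1 := hg hy hx' e.1
        have h2 := hg hx hy' e.2
        subst h1 h2
        exact absurd hxy hxy'.not_gt
      · exact ⟨hg hx hx' e.2, hg hy hy' e.1⟩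
    · rintro ⟨i, j⟩ hp
      simp only [mem_filter, mem_product, mem_image] at hp
      obtain ⟨⟨⟨x, hx, rfl⟩, y, hy, rfl⟩, hlt⟩ := hp
      have hne : h x ≠ h y := fun e => hlt.ne (congrArg g (hh hx hy e))
      rcases lt_or_gt_of_ne hne with hxy | hxy
      · refine ⟨(x, y), by simp [hx, hy, hxy], ?_⟩
        simp only [φ]
        rw [if_pos hlt]
      · refine ⟨(y, x), by simp [hx, hy, hxy], ?_⟩
        simp only [φ]
        rw [if_neg hlt.not_gt]
  rw [← key]
  refine Associated.prod _ _ _ fun p _ => ?_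
  simp only [φ]
  split_ifs
  · exact Associated.refl _
  · exact associated_X_sub_X_comm _ _

theorem diffProd_ne_zero (C : Finset (Fin n)) : diffProd K C ≠ 0 := by
  refine Finset.prod_ne_zero_iff.mpr fun p hp => ?_
  rw [sub_ne_zero]
  exact fun e => (mem_filter.mp hp).2.ne (X_injective e)

theorem columnsPoly_ne_zero (ρ : YoungDiagram) (C : ℕ → Finset (Fin n)) :
    columnsPoly K ρ C ≠ 0 :=
  Finset.prod_ne_zero_iff.mpr fun _ _ => diffProd_ne_zero _

/-- The order of the variables matters only up to sign, so `y` may be placed before all others; its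
pairs then split off. -/
theorem diffProd_insert (C : Finset (Fin n)) {y : Fin n} (hy : y ∉ C) :
    Associated (diffProd K (insert y C)) (diffProd K C * ∏ z ∈ C, (X y - X z)) := by
  classical
  let h : Fin n → WithBot (Fin n) := fun z => if z = y then ⊥ else z
  have hh : Set.InjOn h (insert y C : Finset (Fin n)) := by
    intro a _ b _ e
    simp only [h] at e
    split_ifs at e with h1 h2 h2
    · rw [h1, h2]
    · exact absurd e.symm (WithBot.coe_ne_bot)
    · exact absurd e (WithBot.coe_ne_bot)
    · exact WithBot.coe_injective e
  have := associated_prod_diffProd (K := K) (insert y C) h hh id (Set.injOn_id _)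
  rw [image_id] at this
  refine this.symm.trans ?_
  have hset : (insert y C ×ˢ insert y C).filter (fun p => h p.1 < h p.2) =
      ((C ×ˢ C).filter fun p => p.1 < p.2) ∪ C.image (fun z => (y, z)) := by
    ext ⟨a, b⟩
    simp only [mem_filter, mem_product, mem_insert, mem_union, mem_image, Prod.mk.injEq, h]
    by_cases ha : a = y
    · by_cases hb : b = y
      · subst ha hb
        simp [hy]
      · subst ha
        simp [hb, hy, WithBot.bot_lt_coe]
    · by_cases hb : b = y
      · subst hb
        simp [ha, hy]
      · simp [ha, hb, Ne.symm ha]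
  rw [hset, prod_union, prod_image]
  · rfl
  · intro a _ b _ e
    exact (Prod.mk.inj e).2
  · rw [disjoint_left]
    rintro ⟨a, b⟩ h1 h2
    simp only [mem_filter, mem_product, mem_image, Prod.mk.injEq] at h1 h2
    obtain ⟨z, -, rfl, -⟩ := h2
    exact hy h1.1.1

end Associates

/-! ### Tableaux as families of column sets. -/

section Columns

variable {K : Type*} [Field K] {n l : ℕ} [NeZero n] {ρ : YoungDiagram}

/-- The set of entries of the `j`-th column. -/
def LTableau.column (T : LTableau n l ρ) (j : ℕ) : Finset (Fin n) :=
  (univ.filter fun c : {c : ℕ × ℕ // c ∈ ρ.cells} => c.1.2 = j).image T.entry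

theorem LTableau.entry_injOn (T : LTableau n l ρ) (j : ℕ) :
    Set.InjOn T.entry (univ.filter fun c : {c : ℕ × ℕ // c ∈ ρ.cells} => c.1.2 = j) := by
  intro c hc d hd e
  simp only [coe_filter, mem_univ, true_and, Set.mem_ofPred_eq] at hc hd
  by_cases h0 : T.entry c = 0
  · exact T.col_zero c d h0 (e ▸ h0) (hc.trans hd.symm)
  · obtain ⟨x, hx⟩ := card_eq_one.mp (T.card_ne_zero _ h0)
    have h1 : c ∈ ({x} : Finset _) := hx ▸ by simp
    have h2 : d ∈ ({x} : Finset _) := hx ▸ by simp [e]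
    rw [mem_singleton] at h1 h2
    rw [h1, h2]

theorem LTableau.card_columns (T : LTableau n l ρ) (k : Fin n) :
    #{j ∈ range (ρ.rowLen 0) | k ∈ T.column j} = #{c | T.entry c = k} := by
  symm
  refine Finset.card_bij (fun c _ => c.1.2) ?_ ?_ ?_
  · intro c hc
    have hc' : (c.1.1, c.1.2) ∈ ρ := (YoungDiagram.mem_cells _).mp c.2
    simp only [mem_filter, mem_univ, true_and] at hc
    simp only [mem_filter, mem_range, LTableau.column, mem_image, mem_univ, true_and]
    refine ⟨YoungDiagram.mem_iff_lt_rowLen.mp (ρ.up_left_mem (Nat.zero_le _) le_rfl hc'), c, rfl, hc⟩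
  · intro c hc d hd e
    simp only [mem_filter, mem_univ, true_and] at hc hd
    exact T.entry_injOn d.1.2 (by simp [e]) (by simp) (hc.trans hd.symm)
  · intro j hj
    simp only [mem_filter, LTableau.column, mem_image, mem_univ, true_and] at hj
    obtain ⟨-, c, hc, hk⟩ := hj
    exact ⟨c, by simpa using hk, hc⟩

theorem LTableau.isColumnFamily (T : LTableau n l ρ) : IsColumnFamily l ρ T.column where
  card_eq j := by
    rw [LTableau.column, card_image_of_injOn (T.entry_injOn j), YoungDiagram.colLen_eq_card]
    refine Finset.card_bij (fun c _ => c.1) ?_ ?_ ?_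
    · intro c hc
      rw [YoungDiagram.mem_col_iff]
      exact ⟨(YoungDiagram.mem_cells _).mp c.2, by simpa using hc⟩
    · intro c _ d _ e
      exact Subtype.ext e
    · intro c hc
      rw [YoungDiagram.mem_col_iff] at hc
      exact ⟨⟨c, (YoungDiagram.mem_cells _).mpr hc.1⟩, by simpa using hc.2, rfl⟩
  card_zero := (T.card_columns 0).trans T.card_zero
  card_ne_zero k hk := (T.card_columns k).trans (T.card_ne_zero k hk)

theorem LTableau.associated_columnDelta (T : LTableau n l ρ) (j : ℕ) :
    Associated (T.columnDelta K j) (diffProd K (T.column j)) := by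
  have := associated_prod_diffProd (K := K)
    (univ.filter fun c : {c : ℕ × ℕ // c ∈ ρ.cells} => c.1.2 = j) (fun c => c.1.1)
    (by
      intro c hc d hd e
      simp only [coe_filter, mem_univ, true_and, Set.mem_ofPred_eq] at hc hd
      exact Subtype.ext (Prod.ext e (hc.trans hd.symm)))
    T.entry (T.entry_injOn j)
  convert this using 1
  · rw [LTableau.columnDelta]
    refine prod_congr ?_ fun _ _ => rfl
    ext p
    simp [and_assoc]
  · rfl

theorem LTableau.associated_spechtPoly (T : LTableau n l ρ) :
    Associated (T.spechtPoly K) (columnsPoly K ρ T.column) :=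
  Associated.prod _ _ _ fun j _ => T.associated_columnDelta j

/-- No condition is imposed along rows, so each column set can simply be written in increasing order
from top to bottom. -/
theorem IsColumnFamily.exists_tableau {C : ℕ → Finset (Fin n)} (hC : IsColumnFamily l ρ C) :
    ∃ T : LTableau n l ρ, T.column = C := by
  have hlt : ∀ c : {c : ℕ × ℕ // c ∈ ρ.cells}, c.1.1 < ρ.colLen c.1.2 := fun c =>
    YoungDiagram.mem_iff_lt_colLen.mp ((YoungDiagram.mem_cells _).mp c.2)
  let E : {c : ℕ × ℕ // c ∈ ρ.cells} → Fin n := fun c =>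
    (C c.1.2).orderEmbOfFin (hC.card_eq _) ⟨c.1.1, hlt c⟩
  have hmem : ∀ c, E c ∈ C c.1.2 := fun c => orderEmbOfFin_mem _ _ _
  have hinj : ∀ c d, E c = E d → c.1.2 = d.1.2 → c = d := by
    rintro ⟨⟨i, j⟩, hc⟩ ⟨⟨i', j'⟩, hd⟩ h e
    simp only at e
    subst e
    have := ((C j).orderEmbOfFin (hC.card_eq j)).injective h
    simp only [Fin.mk.injEq] at this
    subst this
    rfl
  have hsurj : ∀ j, ∀ k ∈ C j, ∃ c, c.1.2 = j ∧ E c = k := by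
    intro j k hk
    have : k ∈ Set.range ((C j).orderEmbOfFin (hC.card_eq j)) := by
      rw [range_orderEmbOfFin]
      exact hk
    obtain ⟨i, hi⟩ := this
    exact ⟨⟨(i, j), (YoungDiagram.mem_cells _).mpr (YoungDiagram.mem_iff_lt_colLen.mpr i.2)⟩,
      rfl, hi⟩
  have hcard : ∀ k, #{c | E c = k} = #{j ∈ range (ρ.rowLen 0) | k ∈ C j} := by
    intro k
    refine Finset.card_bij (fun c _ => c.1.2) ?_ ?_ ?_
    · intro c hc
      have hc' : (c.1.1, c.1.2) ∈ ρ := (YoungDiagram.mem_cells _).mp c.2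
      simp only [mem_filter, mem_univ, true_and] at hc
      simp only [mem_filter, mem_range]
      exact ⟨YoungDiagram.mem_iff_lt_rowLen.mp (ρ.up_left_mem (Nat.zero_le _) le_rfl hc'),
        hc ▸ hmem c⟩
    · intro c hc d hd e
      simp only [mem_filter, mem_univ, true_and] at hc hd
      exact hinj c d (hc.trans hd.symm) e
    · intro j hj
      obtain ⟨c, hc, hk⟩ := hsurj j k (mem_filter.mp hj).2
      exact ⟨c, by simpa using hk, hc⟩
  refine ⟨⟨E, (hcard 0).trans hC.card_zero, fun k hk => (hcard k).trans (hC.card_ne_zero k hk),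
    fun c d hc hd => hinj c d (hc.trans hd.symm)⟩, ?_⟩
  funext j
  ext k
  simp only [LTableau.column, mem_image, mem_filter, mem_univ, true_and]
  constructor
  · rintro ⟨c, rfl, rfl⟩
    exact hmem c
  · intro hk
    exact hsurj j k hk

theorem LTableau.spechtPoly_ne_zero (T : LTableau n l ρ) : T.spechtPoly K ≠ 0 :=
  (T.associated_spechtPoly.ne_zero_iff).mpr (columnsPoly_ne_zero _ _)

theorem spechtIdeal_eq_span_columnsPoly :
    spechtIdeal K n l ρ = Ideal.span {f | ∃ C, IsColumnFamily l ρ C ∧ f = columnsPoly K ρ C} := by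
  refine le_antisymm (Ideal.span_le.mpr ?_) (Ideal.span_le.mpr ?_)
  · rintro _ ⟨T, rfl⟩
    exact Ideal.mem_of_dvd _ T.associated_spechtPoly.symm.dvd
      (Ideal.subset_span ⟨T.column, T.isColumnFamily, rfl⟩)
  · rintro _ ⟨C, hC, rfl⟩
    obtain ⟨T, rfl⟩ := hC.exists_tableau
    exact Ideal.mem_of_dvd _ T.associated_spechtPoly.dvd (Ideal.subset_span ⟨T, rfl⟩)

theorem IsColumnFamily.columnsPoly_mem {C : ℕ → Finset (Fin n)} (hC : IsColumnFamily l ρ C) :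
    columnsPoly K ρ C ∈ spechtIdeal K n l ρ := by
  rw [spechtIdeal_eq_span_columnsPoly]
  exact Ideal.subset_span ⟨C, hC, rfl⟩

end Columns

/-! ### Moving one variable between two columns. -/

section Exchange

theorem mul_mem_of_mem_span {R : Type*} [CommRing R] {s : Set R} {I : Ideal R} {x z : R}
    (hx : x ∈ Ideal.span s) (h : ∀ y ∈ s, y * z ∈ I) : x * z ∈ I := by
  induction hx using Submodule.span_induction with
  | mem y hy => exact h y hy
  | zero => rw [zero_mul]; exact I.zero_mem
  | add a b _ _ ha hb => rw [add_mul]; exact I.add_mem ha hb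
  | smul a b _ hb => rw [smul_eq_mul, mul_assoc]; exact I.mul_mem_left _ hb

/-- Lagrange interpolation expresses the leading coefficient `1` of `P` as the sum of the quotients
of `P (v y)` by `∏ (v y - v z)`. Multiplying by `a`, which is divisible by every denominator,
descends this identity from the fraction field. -/
theorem eq_sum_mul_eval_of_monic {R ι : Type*} [CommRing R] [IsDomain R] [DecidableEq ι]
    {s : Finset ι} {v : ι → R} (hv : Set.InjOn v s) {P : Polynomial R}
    (hP : P.Monic) (hd : P.natDegree + 1 = #s) {a : R} {e : ι → R}
    (he : ∀ y ∈ s, a = e y * ∏ z ∈ s.erase y, (v y - v z)) :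
    a = ∑ y ∈ s, e y * P.eval (v y) := by
  let f : R →+* FractionRing R := algebraMap R (FractionRing R)
  have hf : Function.Injective f := IsFractionRing.injective R (FractionRing R)
  have hfv : Set.InjOn (f ∘ v) s := hf.comp_injOn hv
  have hsum := Lagrange.leadingCoeff_eq_sum (s := s) (v := f ∘ v) hfv (P := P.map f) (by
    rw [hP.degree_map, Polynomial.degree_eq_natDegree hP.ne_zero, ← hd]
    norm_cast)
  rw [(hP.map f).leadingCoeff] at hsum
  apply hf
  rw [map_sum, ← mul_one (f a), hsum, mul_sum]
  refine sum_congr rfl fun y hy => ?_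
  have hne : ∏ j ∈ s.erase y, ((f ∘ v) y - (f ∘ v) j) ≠ 0 :=
    prod_ne_zero_iff.mpr fun j hj => sub_ne_zero.mpr fun h =>
      (mem_erase.mp hj).1 (hfv hy (mem_erase.mp hj).2 h).symm
  conv_lhs => rw [he y hy]
  rw [map_mul f, map_mul f, map_prod f, mul_div_assoc', div_eq_iff hne, Function.comp_apply,
    Polynomial.eval_map_apply]
  simp only [map_sub, Function.comp_apply]
  ring

variable {K : Type*} [Field K] {n : ℕ}

/-- Interpolate on `A` a monic polynomial of degree `#A - 1` vanishing on `B`; a power of the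
variable pads the degree. Terms with `y ∈ B` vanish, and in the others the value at `y` supplies the
factors that join `y` to `B`. -/
theorem diffProd_mul_mem_span (A B : Finset (Fin n)) (h : #B < #A) :
    diffProd K A * diffProd K B ∈
      Ideal.span {f | ∃ y ∈ A, y ∉ B ∧ f = diffProd K (A.erase y) * diffProd K (insert y B)} := by
  classical
  let P : Polynomial (MvPolynomial (Fin n) K) :=
    (∏ z ∈ B, (Polynomial.X - Polynomial.C (X z))) * Polynomial.X ^ (#A - 1 - #B)
  have hPm : P.Monic := (Polynomial.monic_prod_X_sub_C X B).mul (Polynomial.monic_X_pow _)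
  have hPd : P.natDegree + 1 = #A := by
    rw [(Polynomial.monic_prod_X_sub_C X B).natDegree_mul (Polynomial.monic_X_pow _),
      Polynomial.natDegree_finsetProd_X_sub_C_eq_card, Polynomial.natDegree_X_pow]
    omega
  have hw : ∀ y ∈ A, ∃ w : MvPolynomial (Fin n) K, diffProd K A =
      w * diffProd K (A.erase y) * ∏ z ∈ A.erase y, (X y - X z) := by
    intro y hy
    have := (diffProd_insert (K := K) (A.erase y) (notMem_erase y A)).symm.dvd
    rw [insert_erase hy] at this
    obtain ⟨w, hw⟩ := this
    exact ⟨w, by rw [hw]; ring⟩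
  choose! w hw using hw
  have hA := eq_sum_mul_eval_of_monic X_injective.injOn hPm hPd hw
  simp only [P, Polynomial.eval_mul, Polynomial.eval_prod, Polynomial.eval_sub,
    Polynomial.eval_X, Polynomial.eval_C, Polynomial.eval_pow] at hA
  rw [hA, sum_mul]
  refine Ideal.sum_mem _ fun y hy => ?_
  by_cases hyB : y ∈ B
  · rw [prod_eq_zero hyB (sub_self _)]
    simp
  · obtain ⟨u, hu⟩ := (diffProd_insert (K := K) B hyB).dvd
    have : w y * diffProd K (A.erase y) * ((∏ z ∈ B, (X y - X z)) * X y ^ (#A - 1 - #B)) *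
        diffProd K B = (w y * X y ^ (#A - 1 - #B) * u) *
          (diffProd K (A.erase y) * diffProd K (insert y B)) := by
      linear_combination (w y * X y ^ (#A - 1 - #B) * diffProd K (A.erase y)) * hu
    rw [this]
    exact Ideal.mul_mem_left _ _ (Ideal.subset_span ⟨y, hy, hyB, rfl⟩)

end Exchange

/-! ### Row and column lengths of Young diagrams. -/

section Diagrams

theorem YoungDiagram.colLen_eq_zero_of_le (ρ : YoungDiagram) {j : ℕ} (h : ρ.rowLen 0 ≤ j) :
    ρ.colLen j = 0 := by
  by_contra h0
  have := YoungDiagram.mem_iff_lt_rowLen.mp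
    (YoungDiagram.mem_iff_lt_colLen.mpr (Nat.pos_of_ne_zero h0))
  omega

theorem YoungDiagram.colLen_eq_card_filter (ρ : YoungDiagram) {N : ℕ} (hN : ρ.rowLen N = 0)
    (j : ℕ) : ρ.colLen j = #{i ∈ range N | j < ρ.rowLen i} := by
  have : ({i ∈ range N | j < ρ.rowLen i} : Finset ℕ) = range (ρ.colLen j) := by
    ext i
    simp only [mem_filter, mem_range, ← YoungDiagram.mem_iff_lt_rowLen,
      ← YoungDiagram.mem_iff_lt_colLen, and_iff_right_iff_imp]
    intro h
    by_contra hi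
    have h1 := ρ.rowLen_anti N i (not_lt.mp hi)
    have h2 := YoungDiagram.mem_iff_lt_rowLen.mp h
    omega
  rw [this, card_range]

theorem YoungDiagram.card_eq_sum_rowLen (ρ : YoungDiagram) {N : ℕ} (hN : ρ.rowLen N = 0) :
    ρ.card = ∑ i ∈ range N, ρ.rowLen i := by
  have hmem : ∀ c ∈ ρ.cells, c.1 ∈ range N := by
    rintro ⟨i, j⟩ hc
    rw [mem_range]
    by_contra hi
    have h1 := ρ.rowLen_anti N i (not_lt.mp hi)
    have h2 := YoungDiagram.mem_iff_lt_rowLen.mp ((YoungDiagram.mem_cells _).mp hc)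
    omega
  rw [YoungDiagram.card, card_eq_sum_card_fiberwise hmem]
  exact sum_congr rfl fun i _ => (ρ.rowLen_eq_card).symm

theorem YoungDiagram.rowLen_card (ρ : YoungDiagram) : ρ.rowLen ρ.card = 0 := by
  by_contra h
  have h1 : (range (ρ.card + 1)).image (fun i => (i, 0)) ⊆ ρ.cells := by
    intro c hc
    obtain ⟨i, hi, rfl⟩ := mem_image.mp hc
    rw [mem_range] at hi
    rw [YoungDiagram.mem_cells, YoungDiagram.mem_iff_lt_rowLen]
    have := ρ.rowLen_anti i ρ.card (by omega)
    omega
  have h2 := card_le_card h1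
  rw [card_image_of_injective _ (fun a b e => (Prod.mk.inj e).1), card_range] at h2
  change ρ.card + 1 ≤ ρ.card at h2
  omega

theorem YoungDiagram.rowLen_eq_zero (ρ : YoungDiagram) {i : ℕ} (h : ρ.card ≤ i) :
    ρ.rowLen i = 0 := by
  have := ρ.rowLen_anti _ _ h
  rw [ρ.rowLen_card] at this
  omega

theorem YoungDiagram.ext_rowLen {ρ μ : YoungDiagram} (h : ∀ i, ρ.rowLen i = μ.rowLen i) :
    ρ = μ := by
  refine YoungDiagram.ext (Finset.ext fun c => ?_)
  obtain ⟨i, j⟩ := c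
  simp only [YoungDiagram.mem_cells, YoungDiagram.mem_iff_lt_rowLen, h]

theorem YoungDiagram.exists_rowLen_eq (c : ℕ → ℕ) (hc : Antitone c) {N : ℕ} (hN : c N = 0) :
    ∃ ρ : YoungDiagram, ∀ i, ρ.rowLen i = c i := by
  classical
  let ρ : YoungDiagram :=
    { cells := (range N ×ˢ range (c 0)).filter fun p => p.2 < c p.1
      isLowerSet := by
        rintro ⟨i, j⟩ ⟨i', j'⟩ h hm
        obtain ⟨h1, h2⟩ : i' ≤ i ∧ j' ≤ j := h
        simp only [coe_filter, mem_product, mem_range, Set.mem_ofPred_eq] at hm ⊢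
        have := hc h1
        omega }
  have hmem : ∀ i j, (i, j) ∈ ρ ↔ j < c i := by
    intro i j
    rw [← YoungDiagram.mem_cells]
    simp only [ρ, mem_filter, mem_product, mem_range, and_iff_right_iff_imp]
    intro h
    refine ⟨?_, h.trans_le (hc (Nat.zero_le _))⟩
    by_contra hi
    have := hc (not_lt.mp hi)
    omega
  refine ⟨ρ, fun i => eq_of_forall_lt_iff fun j => ?_⟩
  rw [← hmem, YoungDiagram.mem_iff_lt_rowLen]

end Diagrams

/-! ### Inclusion of Specht ideals under one box move. -/

section Inclusion

theorem filter_range_eq_of_eq_empty {n : ℕ} {C : ℕ → Finset (Fin n)} {N M : ℕ}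
    (h : ∀ j, M ≤ j → C j = ∅) (hN : M ≤ N) (k : Fin n) :
    {j ∈ range N | k ∈ C j} = {j ∈ range M | k ∈ C j} := by
  ext j
  simp only [mem_filter, mem_range, and_congr_left_iff]
  intro hk
  refine ⟨fun _ => ?_, fun _ => by omega⟩
  by_contra hj
  rw [h j (not_lt.mp hj)] at hk
  exact absurd hk (notMem_empty _)

variable {K : Type*} [Field K] {n l : ℕ} [NeZero n] {ρ : YoungDiagram}

theorem IsColumnFamily.eq_empty {C : ℕ → Finset (Fin n)} (hC : IsColumnFamily l ρ C) {j : ℕ}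
    (hj : ρ.rowLen 0 ≤ j) : C j = ∅ := by
  rw [← card_eq_zero, hC.card_eq, ρ.colLen_eq_zero_of_le hj]

theorem isColumnFamily_iff {C : ℕ → Finset (Fin n)} {N : ℕ} (hN : ρ.rowLen 0 ≤ N) :
    IsColumnFamily l ρ C ↔ (∀ j, (C j).card = ρ.colLen j) ∧ #{j ∈ range N | 0 ∈ C j} = l ∧
      ∀ k : Fin n, k ≠ 0 → #{j ∈ range N | k ∈ C j} = 1 := by
  have he : (∀ j, (C j).card = ρ.colLen j) → ∀ j, ρ.rowLen 0 ≤ j → C j = ∅ := fun h j hj => by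
    rw [← card_eq_zero, h, ρ.colLen_eq_zero_of_le hj]
  constructor
  · intro h
    simp only [filter_range_eq_of_eq_empty (he h.card_eq) hN]
    exact ⟨h.1, h.2, h.3⟩
  · rintro ⟨h1, h2, h3⟩
    simp only [filter_range_eq_of_eq_empty (he h1) hN] at h2 h3
    exact ⟨h1, h2, h3⟩

theorem IsColumnFamily.columnsPoly_eq {C : ℕ → Finset (Fin n)} (hC : IsColumnFamily l ρ C)
    {N : ℕ} (hN : ρ.rowLen 0 ≤ N) : columnsPoly K ρ C = ∏ j ∈ range N, diffProd K (C j) := by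
  refine prod_subset (range_subset_range.mpr hN) fun j _ hj => ?_
  rw [hC.eq_empty (by simpa using hj)]
  simp [diffProd]

/-- The exchange relation is applied to columns `q` and `p`, the rest being a common factor. Moving
`y` preserves how often each number occurs, so every term is a multiple of a generator for `ρ'`. -/
theorem spechtIdeal_le_of_move {ρ' : YoungDiagram} {p q : ℕ} (hpq : p ≠ q)
    (hq : ρ.colLen q = ρ'.colLen q + 1) (hp : ρ'.colLen p = ρ.colLen p + 1)
    (hj : ∀ j, j ≠ p → j ≠ q → ρ'.colLen j = ρ.colLen j) (hlt : ρ.colLen p < ρ.colLen q) :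
    spechtIdeal K n l ρ ≤ spechtIdeal K n l ρ' := by
  classical
  rw [spechtIdeal_eq_span_columnsPoly, Ideal.span_le]
  rintro _ ⟨C, hC, rfl⟩
  -- A common range for both diagrams; the columns beyond either diagram are empty and contribute
  -- the factor `1`.
  let N := ρ.rowLen 0 + ρ'.rowLen 0 + p + q + 1
  have hN : ρ.rowLen 0 ≤ N := by omega
  have hN' : ρ'.rowLen 0 ≤ N := by omega
  have hpN : p ∈ range N := by rw [mem_range]; omega
  have hqN : q ∈ (range N).erase p := by rw [mem_erase, mem_range]; exact ⟨hpq.symm, by omega⟩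
  rw [SetLike.mem_coe, hC.columnsPoly_eq hN, ← mul_prod_erase _ _ hpN, ← mul_prod_erase _ _ hqN,
    ← mul_assoc, mul_comm (diffProd K (C p))]
  set R := ∏ x ∈ ((range N).erase p).erase q, diffProd K (C x) with hR
  have hmem := diffProd_mul_mem_span (K := K) (C q) (C p) (by rw [hC.card_eq, hC.card_eq]; exact hlt)
  refine mul_mem_of_mem_span hmem ?_
  rintro _ ⟨y, hyA, hyB, rfl⟩
  let C' : ℕ → Finset (Fin n) :=
    Function.update (Function.update C q ((C q).erase y)) p (insert y (C p))
  have hp' : C' p = insert y (C p) := by simp [C']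
  have hq' : C' q = (C q).erase y := by simp [C', hpq.symm]
  have hj' : ∀ j, j ≠ p → j ≠ q → C' j = C j := fun j h1 h2 => by simp [C', h1, h2]
  have hcount : ∀ k, #{j ∈ range N | k ∈ C' j} = #{j ∈ range N | k ∈ C j} := by
    intro k
    by_cases hk : k = y
    · subst hk
      have : {j ∈ range N | k ∈ C' j} = insert p ({j ∈ range N | k ∈ C j}.erase q) := by
        ext j
        simp only [mem_filter, mem_insert, mem_erase]
        by_cases h1 : j = p
        · subst h1
          simp [hp', hpN]
        · by_cases h2 : j = q
          · subst h2
            simp [hq', h1]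
          · simp [hj' j h1 h2, h1, h2]
      have hq2 : q ∈ {j ∈ range N | k ∈ C j} := by
        simp only [mem_filter]
        exact ⟨(mem_erase.mp hqN).2, hyA⟩
      rw [this, card_insert_of_notMem, card_erase_of_mem hq2]
      · have := card_pos.mpr ⟨q, hq2⟩
        omega
      · simp [hyB]
    · congr 1
      ext j
      simp only [mem_filter, and_congr_right_iff]
      intro _
      by_cases h1 : j = p
      · subst h1
        simp [hp', hk]
      · by_cases h2 : j = q
        · subst h2
          simp [hq', hk]
        · rw [hj' j h1 h2]
  have hC' : IsColumnFamily l ρ' C' := by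
    obtain ⟨h1, h2, h3⟩ := (isColumnFamily_iff hN).mp hC
    rw [isColumnFamily_iff hN']
    simp only [hcount]
    refine ⟨fun j => ?_, h2, h3⟩
    by_cases hjp : j = p
    · subst hjp
      rw [hp', card_insert_of_notMem hyB, h1, hp]
    · by_cases hjq : j = q
      · subst hjq
        rw [hq', card_erase_of_mem hyA, h1, hq]
        rfl
      · rw [hj' j hjp hjq, h1, hj j hjp hjq]
  have := hC'.columnsPoly_mem (K := K)
  rw [hC'.columnsPoly_eq hN', ← mul_prod_erase _ _ hpN, ← mul_prod_erase _ _ hqN,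
    ← mul_assoc, mul_comm (diffProd K (C' p)), hp', hq',
    prod_congr rfl fun j hj => by
      rw [hj' j (mem_erase.mp (mem_erase.mp hj).2).1 (mem_erase.mp hj).1]] at this
  exact this

end Inclusion

/-! ### Dominance order and inclusion of ideals. -/

section Dominance

/-- Two distinct partitions comparable in the dominance order are linked by moving a box of the
smaller one to a higher row. -/
theorem Dominates.exists_move {ρ μ : YoungDiagram} (hcard : ρ.card = μ.card)
    (h : Dominates μ ρ) (hne : ρ ≠ μ) :
    ∃ (ρ' : YoungDiagram) (p q : ℕ), p ≠ q ∧ ρ.colLen q = ρ'.colLen q + 1 ∧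
      ρ'.colLen p = ρ.colLen p + 1 ∧ (∀ j, j ≠ p → j ≠ q → ρ'.colLen j = ρ.colLen j) ∧
      ρ.colLen p < ρ.colLen q ∧ ρ'.card = ρ.card ∧ Dominates μ ρ' ∧
      (∀ k, ∑ i ∈ range k, ρ.rowLen i ≤ ∑ i ∈ range k, ρ'.rowLen i) ∧
      ∃ k ≤ ρ.card, ∑ i ∈ range k, ρ.rowLen i < ∑ i ∈ range k, ρ'.rowLen i := by
  classical
  set N := ρ.card with hN
  have hρ0 : ∀ t, N ≤ t → ρ.rowLen t = 0 := fun t ht => ρ.rowLen_eq_zero ht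
  have hμ0 : ∀ t, N ≤ t → μ.rowLen t = 0 := fun t ht => μ.rowLen_eq_zero (hcard ▸ ht)
  have hex : ∃ i, ρ.rowLen i ≠ μ.rowLen i := by
    by_contra hcon
    push Not at hcon
    exact hne (YoungDiagram.ext_rowLen hcon)
  obtain ⟨i, hi, hmin⟩ : ∃ i, ρ.rowLen i ≠ μ.rowLen i ∧ ∀ t < i, ρ.rowLen t = μ.rowLen t :=
    ⟨Nat.find hex, Nat.find_spec hex, fun t ht => not_not.mp (Nat.find_min hex ht)⟩
  have hiN : i < N := by
    by_contra hc
    exact hi (by rw [hρ0 i (by omega), hμ0 i (by omega)])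
  have hSi : ∑ t ∈ range i, ρ.rowLen t = ∑ t ∈ range i, μ.rowLen t :=
    sum_congr rfl fun t ht => hmin t (mem_range.mp ht)
  have hlt : ρ.rowLen i < μ.rowLen i := by
    have := h (i + 1)
    rw [sum_range_succ, sum_range_succ, hSi] at this
    omega
  have hex2 : ∃ j, i < j ∧ ∑ t ∈ range (j + 1), ρ.rowLen t = ∑ t ∈ range (j + 1), μ.rowLen t :=
    ⟨N, hiN, by rw [← ρ.card_eq_sum_rowLen (hρ0 _ (by omega)),
      ← μ.card_eq_sum_rowLen (hμ0 _ (by omega))]; exact hcard⟩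
  -- Row `i` is the first where the partitions differ, and row `j` the first later row after which
  -- the partial sums agree again. In between they differ strictly, which leaves room to move a box
  -- from row `j` to row `i` and stay below `μ`.
  obtain ⟨j, ⟨hij, hSj⟩, hjmin⟩ : ∃ j, (i < j ∧
      ∑ t ∈ range (j + 1), ρ.rowLen t = ∑ t ∈ range (j + 1), μ.rowLen t) ∧ ∀ t < j, ¬ (i < t ∧
      ∑ s ∈ range (t + 1), ρ.rowLen s = ∑ s ∈ range (t + 1), μ.rowLen s) :=
    ⟨Nat.find hex2, Nat.find_spec hex2, fun t ht => Nat.find_min hex2 ht⟩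
  have hstrict : ∀ k, i < k → k ≤ j → ∑ t ∈ range k, ρ.rowLen t < ∑ t ∈ range k, μ.rowLen t := by
    intro k hk hkj
    refine lt_of_le_of_ne (h k) fun e => ?_
    obtain ⟨k, rfl⟩ : ∃ k', k = k' + 1 := ⟨k - 1, by omega⟩
    by_cases hki : k = i
    · subst hki
      rw [sum_range_succ, sum_range_succ] at e
      omega
    · exact hjmin k (by omega) ⟨by omega, e⟩
  have hjgt : μ.rowLen j < ρ.rowLen j := by
    have := hstrict j hij le_rfl
    rw [sum_range_succ, sum_range_succ] at hSj
    omega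
  have hjN : j < N := by
    by_contra hc
    rw [hρ0 j (by omega)] at hjgt
    omega
  -- Row `j` ends in a removable corner: agreement of the sums through row `j` gives `ρ.rowLen (j +
  -- 1) ≤ μ.rowLen (j + 1) ≤ μ.rowLen j < ρ.rowLen j`.
  have hjsucc : ρ.rowLen (j + 1) < ρ.rowLen j := by
    have h1 := h (j + 2)
    rw [sum_range_succ, sum_range_succ _ (j + 1), hSj] at h1
    have h2 := μ.rowLen_anti j (j + 1) (by omega)
    omega
  let c : ℕ → ℕ := fun t =>
    if t = i then ρ.rowLen i + 1 else if t = j then ρ.rowLen j - 1 else ρ.rowLen t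
  have hci : c i = ρ.rowLen i + 1 := by simp [c]
  have hcj : c j = ρ.rowLen j - 1 := by simp [c, hij.ne']
  have hct : ∀ t, t ≠ i → t ≠ j → c t = ρ.rowLen t := fun t h1 h2 => by simp [c, h1, h2]
  have hc : Antitone c := by
    refine antitone_nat_of_succ_le fun t => ?_
    have h0 := ρ.rowLen_anti t (t + 1) (by omega)
    by_cases h1 : t = i
    · subst h1
      by_cases h2 : t + 1 = j
      · subst h2
        omega
      · rw [hci, hct _ (by omega) h2]
        omega
    · by_cases h2 : t = j
      · subst h2
        rw [hcj, hct _ (by omega) (by omega)]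
        omega
      · rw [hct t h1 h2]
        by_cases h3 : t + 1 = i
        · subst h3
          rw [hci, hmin t (by omega)]
          have := μ.rowLen_anti t (t + 1) (by omega)
          omega
        · by_cases h4 : t + 1 = j
          · subst h4
            omega
          · rw [hct _ h3 h4]
            exact h0
  obtain ⟨ρ', hρ'⟩ := YoungDiagram.exists_rowLen_eq c hc (N := N)
    (by rw [hct _ (by omega) (by omega)]; exact hρ0 _ le_rfl)
  have hsum : ∀ k, ∑ t ∈ range k, ρ'.rowLen t + (if j < k then 1 else 0) =
      ∑ t ∈ range k, ρ.rowLen t + (if i < k then 1 else 0) := by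
    intro k
    induction k with
    | zero => simp
    | succ k ih =>
      rw [sum_range_succ, sum_range_succ, hρ']
      by_cases h1 : k = i
      · subst h1
        rw [hci]
        split_ifs at ih ⊢ <;> omega
      · by_cases h2 : k = j
        · subst h2
          rw [hcj]
          split_ifs at ih ⊢ <;> omega
        · rw [hct k h1 h2]
          split_ifs at ih ⊢ <;> omega
  have hρ'0 : ρ'.rowLen N = 0 := by
    rw [hρ', hct _ (by omega) (by omega)]
    exact hρ0 _ le_rfl
  have hpq : ρ.rowLen j ≤ ρ.rowLen i := ρ.rowLen_anti i j hij.le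
  have hcol := fun x => ρ.colLen_eq_card_filter (hρ0 N le_rfl) x
  have hcol' := fun x => ρ'.colLen_eq_card_filter hρ'0 x
  -- With columns counted from `0`, the box leaves the last column of row `j` and lands just past
  -- the end of row `i`.
  refine ⟨ρ', ρ.rowLen i, ρ.rowLen j - 1, by omega, ?_, ?_, ?_, ?_, ?_, ?_, ?_, i + 1, by omega, ?_⟩
  · rw [hcol, hcol', ← card_insert_of_notMem (a := j)]
    · congr 1
      ext t
      simp only [mem_filter, mem_insert, mem_range, hρ']
      by_cases h1 : t = i
      · subst h1
        rw [hci]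
        omega
      · by_cases h2 : t = j
        · subst h2
          rw [hcj]
          omega
        · rw [hct t h1 h2]
          omega
    · simp [hρ', hcj]
  · rw [hcol, hcol', ← card_insert_of_notMem (a := i)]
    · congr 1
      ext t
      simp only [mem_filter, mem_insert, mem_range, hρ']
      by_cases h1 : t = i
      · subst h1
        rw [hci]
        omega
      · by_cases h2 : t = j
        · subst h2
          rw [hcj]
          omega
        · rw [hct t h1 h2]
          omega
    · simp
  · intro x hx1 hx2
    rw [hcol, hcol']
    congr 1
    ext t
    simp only [mem_filter, mem_range, hρ']
    by_cases h1 : t = i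
    · subst h1
      rw [hci]
      omega
    · by_cases h2 : t = j
      · subst h2
        rw [hcj]
        omega
      · rw [hct t h1 h2]
  · have h1 : j < ρ.colLen (ρ.rowLen j - 1) := by
      rw [← YoungDiagram.mem_iff_lt_colLen, YoungDiagram.mem_iff_lt_rowLen]
      omega
    have h2 : ¬ j < ρ.colLen (ρ.rowLen i) := by
      rw [← YoungDiagram.mem_iff_lt_colLen, YoungDiagram.mem_iff_lt_rowLen]
      omega
    omega
  · refine (ρ'.card_eq_sum_rowLen hρ'0).trans (Eq.trans ?_ (ρ.card_eq_sum_rowLen (hρ0 N le_rfl)).symm)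
    have := hsum N
    rw [if_pos hjN, if_pos hiN] at this
    omega
  · intro k
    have h1 := hsum k
    have h2 := h k
    have h3 := hstrict k
    split_ifs at h1 <;> omega
  · intro k
    have h1 := hsum k
    split_ifs at h1 <;> omega
  · have h1 := hsum (i + 1)
    split_ifs at h1 <;> omega

theorem spechtIdeal_le_of_dominates {K : Type*} [Field K] {n l : ℕ} [NeZero n]
    {ρ μ : YoungDiagram} (hcard : ρ.card = μ.card) (h : Dominates μ ρ) :
    spechtIdeal K n l ρ ≤ spechtIdeal K n l μ := by
  -- The measure is the total gap between the partial sums; a move lowers none of the sums for `ρ`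
  -- and raises at least one within this range.
  induction hd : (∑ k ∈ range (μ.card + 1), ∑ i ∈ range k, μ.rowLen i) -
    ∑ k ∈ range (μ.card + 1), ∑ i ∈ range k, ρ.rowLen i using Nat.strong_induction_on
    generalizing ρ with
  | _ d ih =>
    by_cases hne : ρ = μ
    · rw [hne]
    · obtain ⟨ρ', p, q, hpq, hq, hp, hj, hlt, hc, hdom, hle, k, hk, hks⟩ := h.exists_move hcard hne
      refine (spechtIdeal_le_of_move hpq hq hp hj hlt).trans
        (ih _ ?_ (hc.trans hcard) hdom rfl)
      have h1 : ∑ k ∈ range (μ.card + 1), ∑ i ∈ range k, ρ.rowLen i <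
          ∑ k ∈ range (μ.card + 1), ∑ i ∈ range k, ρ'.rowLen i :=
        sum_lt_sum (fun k _ => hle k) ⟨k, by rw [mem_range]; omega, hks⟩
      have h2 : ∑ k ∈ range (μ.card + 1), ∑ i ∈ range k, ρ'.rowLen i ≤
          ∑ k ∈ range (μ.card + 1), ∑ i ∈ range k, μ.rowLen i :=
        sum_le_sum fun k _ => hdom k
      omega

end Dominance

/-! ### A Gröbner criterion and leading exponents. -/

section Degree

/-- A remainder on division by `G` has no monomial divisible by a leading monomial of `G`, so a
remainder in `I` must be zero. This is why any monomial of `r` will do in the hypothesis. The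
leading monomial of `f` then occurs in one summand `q b * b`, whose degree does not exceed it, so it
is the degree of that summand. -/
theorem isGroebnerBasis_of_exists_mem_support {σ K : Type*} [Field K] (m : MonomialOrder σ)
    {G : Set (MvPolynomial σ K)} {I : Ideal (MvPolynomial σ K)} (hfin : G.Finite)
    (hne : ∀ g ∈ G, g ≠ 0) (hsub : ∀ g ∈ G, g ∈ I)
    (h : ∀ r ∈ I, r ≠ 0 → ∃ u ∈ r.support, ∃ g ∈ G, m.degree g ≤ u) :
    IsGroebnerBasis m G I := by
  refine ⟨hfin, hne, hsub, le_antisymm (Ideal.span_le.mpr ?_) (Ideal.span_mono ?_)⟩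
  · rintro _ ⟨f, ⟨hfI, hf0⟩, rfl⟩
    suffices ∃ g ∈ G, m.degree g ≤ m.degree f by
      obtain ⟨g, hg, hle⟩ := this
      have hmem : monomial (m.degree g) (1 : K) ∈ initialIdeal m G :=
        Ideal.subset_span ⟨g, ⟨hg, hne g hg⟩, rfl⟩
      have := (initialIdeal m G).mul_mem_left (monomial (m.degree f - m.degree g) (1 : K)) hmem
      rwa [monomial_mul, one_mul, tsub_add_cancel_of_le hle] at this
    obtain ⟨q, r, hqr, hdeg, hr⟩ := m.div_set
      (fun b hb => (m.leadingCoeff_ne_zero_iff.mpr (hne b hb)).isUnit) f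
    have hqI : Finsupp.linearCombination _ (fun b : G => (b : MvPolynomial σ K)) q ∈ I := by
      rw [Finsupp.linearCombination_apply]
      exact I.sum_mem fun b _ => I.mul_mem_left _ (hsub b b.2)
    have hrI : r ∈ I := by
      have := I.sub_mem hfI hqI
      rwa [hqr, add_sub_cancel_left] at this
    have hr0 : r = 0 := by
      by_contra hr0
      obtain ⟨u, hu, g, hg, hle⟩ := h r hrI hr0
      exact hr u hu g hg hle
    rw [hr0, add_zero, Finsupp.linearCombination_apply, Finsupp.sum] at hqr
    have hc : coeff (m.degree f) f ≠ 0 := m.coeff_degree_ne_zero_iff.mpr hf0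
    have hc2 : ∑ b ∈ q.support, coeff (m.degree f) (q b • (b : MvPolynomial σ K)) ≠ 0 := by
      rw [← coeff_sum, ← hqr]
      exact hc
    obtain ⟨b, -, hb⟩ := exists_ne_zero_of_sum_ne_zero hc2
    rw [smul_eq_mul, mul_comm] at hb
    have hb0 : (b : MvPolynomial σ K) * q b ≠ 0 := fun e => hb (by rw [e, coeff_zero])
    have he : m.degree f = m.degree ((b : MvPolynomial σ K) * q b) :=
      m.toSyn.injective (le_antisymm (m.le_degree (mem_support_iff.mpr hb)) (hdeg b))
    refine ⟨b, b.2, ?_⟩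
    rw [he, m.degree_mul' hb0]
    exact le_self_add
  · exact Set.image_mono fun g hg => ⟨hsub g hg.1, hg.2⟩

theorem MonomialOrder.toSyn_single_injective {σ : Type*} (m : MonomialOrder σ) :
    Function.Injective fun i => m.toSyn (Finsupp.single i 1) :=
  m.toSyn.injective.comp (Finsupp.single_left_injective one_ne_zero)

theorem degree_X_sub_X_of_lt {σ K : Type*} [Field K] (m : MonomialOrder σ) {i j : σ}
    (h : m.toSyn (Finsupp.single j 1) < m.toSyn (Finsupp.single i 1)) :
    m.degree (X i - X j : MvPolynomial σ K) = Finsupp.single i 1 := by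
  rw [m.degree_sub_of_lt, m.degree_X]
  rw [m.degree_X, m.degree_X]
  exact h

variable {K : Type*} [Field K] {n : ℕ} (m : MonomialOrder (Fin n))

theorem MonomialOrder.degree_eq_of_associated {f g : MvPolynomial (Fin n) K}
    (h : Associated f g) : m.degree f = m.degree g := by
  by_cases hf : f = 0
  · subst hf
    rw [h.eq_zero_iff.mp rfl]
  · have key : ∀ f g : MvPolynomial (Fin n) K, g ≠ 0 → f ∣ g → m.degree f ≤ m.degree g := by
      rintro f _ hg ⟨q, rfl⟩
      rw [m.degree_mul' hg]
      exact le_self_add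
    exact le_antisymm (key _ _ (h.ne_zero_iff.mp hf) h.dvd) (key _ _ hf h.symm.dvd)

/-- Each factor contributes the larger of its two variables, so `k` is counted once for each smaller
variable of `C`. -/
theorem degree_diffProd_apply_le (C : Finset (Fin n)) (k : Fin n) :
    m.degree (diffProd K C) k ≤ if k ∈ C then
      #{i ∈ C | m.toSyn (Finsupp.single i 1) < m.toSyn (Finsupp.single k 1)} else 0 := by
  classical
  rw [diffProd, m.degree_prod]
  swap
  · exact fun p hp => sub_ne_zero.mpr fun e => (mem_filter.mp hp).2.ne (X_injective e)
  rw [Finsupp.finsetSum_apply]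
  let κ : Fin n → m.syn := fun i => m.toSyn (Finsupp.single i 1)
  have hterm : ∀ p ∈ (C ×ˢ C).filter (fun p => p.1 < p.2),
      m.degree (X p.1 - X p.2 : MvPolynomial (Fin n) K) k =
        if (p.1 = k ∧ κ p.2 < κ k) ∨ (p.2 = k ∧ κ p.1 < κ k) then 1 else 0 := by
    rintro ⟨i, j⟩ hp
    have hij : κ i ≠ κ j := fun e => (mem_filter.mp hp).2.ne (m.toSyn_single_injective e)
    rcases lt_or_gt_of_ne hij with hlt | hlt
    · rw [m.degree_eq_of_associated (associated_X_sub_X_comm i j), degree_X_sub_X_of_lt m hlt,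
        Finsupp.single_apply]
      refine if_congr ⟨?_, ?_⟩ rfl rfl
      · rintro rfl
        exact Or.inr ⟨rfl, hlt⟩
      · rintro (⟨rfl, h⟩ | ⟨rfl, -⟩)
        · exact absurd h hlt.not_gt
        · rfl
    · rw [degree_X_sub_X_of_lt m hlt, Finsupp.single_apply]
      refine if_congr ⟨?_, ?_⟩ rfl rfl
      · rintro rfl
        exact Or.inl ⟨rfl, hlt⟩
      · rintro (⟨rfl, -⟩ | ⟨rfl, h⟩)
        · rfl
        · exact absurd h hlt.not_gt
  rw [sum_congr rfl hterm, sum_boole, Nat.cast_id]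
  split_ifs with hk
  · refine card_le_card_of_injOn (fun p => if p.1 = k then p.2 else p.1) ?_ ?_
    · rintro ⟨i, j⟩ hp
      simp only [coe_filter, mem_filter, mem_product, Set.mem_ofPred_eq] at hp
      obtain ⟨⟨⟨hi, hj⟩, hij⟩, h⟩ := hp
      simp only [coe_filter, Set.mem_ofPred_eq]
      split_ifs with hik
      · rcases h with h | h
        · exact ⟨hj, h.2⟩
        · exact absurd (hik.trans h.1.symm) hij.ne
      · rcases h with h | h
        · exact absurd h.1 hik
        · exact ⟨hi, h.2⟩
    · rintro ⟨i, j⟩ hp ⟨i', j'⟩ hp' e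
      simp only [coe_filter, mem_filter, mem_product, Set.mem_ofPred_eq] at hp hp'
      obtain ⟨⟨-, hij⟩, h⟩ := hp
      obtain ⟨⟨-, hij'⟩, h'⟩ := hp'
      simp only at e
      rw [Prod.mk.injEq]
      have h1 : i = k ∨ j = k := h.imp And.left And.left
      have h2 : i' = k ∨ j' = k := h'.imp And.left And.left
      clear h h'
      split_ifs at e <;> grind
  · rw [Nat.le_zero, card_eq_zero, filter_eq_empty_iff]
    rintro ⟨i, j⟩ hp
    simp only [mem_filter, mem_product] at hp
    rintro (⟨rfl, -⟩ | ⟨rfl, -⟩)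
    · exact hk hp.1.1
    · exact hk hp.1.2

theorem degree_columnsPoly_apply_le (ρ : YoungDiagram) (C : ℕ → Finset (Fin n)) (k : Fin n) :
    m.degree (columnsPoly K ρ C) k ≤ ∑ j ∈ range (ρ.rowLen 0) with k ∈ C j,
      #{i ∈ C j | m.toSyn (Finsupp.single i 1) < m.toSyn (Finsupp.single k 1)} := by
  rw [columnsPoly, m.degree_prod fun j _ => diffProd_ne_zero _, Finsupp.finsetSum_apply, sum_filter]
  exact sum_le_sum fun j _ => degree_diffProd_apply_le m _ _

end Degree

/-! ### Lattice words and the boxes they add. -/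

section Words

/-- Starting from row lengths `c` and adding one box to row `r k` for `k = N - 1, …, 0`, the row
lengths are weakly decreasing at every stage. -/
def IsLatticeWord {N : ℕ} (c : ℕ → ℕ) (r : Fin N → ℕ) : Prop :=
  ∀ j : ℕ, Antitone fun i => c i + #{k : Fin N | j ≤ k ∧ r k = i}

/-- The row lengths after reading the whole word. -/
def wordShape {N : ℕ} (c : ℕ → ℕ) (r : Fin N → ℕ) (i : ℕ) : ℕ := c i + #{k : Fin N | r k = i}

/-- The column of the box added by the `k`-th letter. -/
def wordCol {N : ℕ} (c : ℕ → ℕ) (r : Fin N → ℕ) (k : Fin N) : ℕ :=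
  c (r k) + #{k' : Fin N | k < k' ∧ r k' = r k}

variable {N : ℕ} {c : ℕ → ℕ} {r : Fin N → ℕ}

theorem IsLatticeWord.antitone_wordShape (h : IsLatticeWord c r) : Antitone (wordShape c r) := by
  have := h 0
  simp only [Nat.zero_le, true_and] at this
  exact this

theorem wordCol_add_one (k : Fin N) :
    wordCol c r k + 1 = c (r k) + #{k' : Fin N | (k : ℕ) ≤ k' ∧ r k' = r k} := by
  have : ({k' : Fin N | (k : ℕ) ≤ k' ∧ r k' = r k} : Finset (Fin N)) =
      insert k ({k' : Fin N | k < k' ∧ r k' = r k} : Finset (Fin N)) := by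
    ext k'
    simp only [mem_filter, mem_univ, true_and, mem_insert, Fin.val_fin_le]
    rw [le_iff_eq_or_lt]
    constructor
    · rintro ⟨rfl | h1, h2⟩
      · exact Or.inl rfl
      · exact Or.inr ⟨h1, h2⟩
    · rintro (rfl | ⟨h1, h2⟩)
      · exact ⟨Or.inl rfl, rfl⟩
      · exact ⟨Or.inr h1, h2⟩
  rw [this, card_insert_of_notMem (by simp), wordCol, add_assoc]

theorem wordCol_lt_wordShape (k : Fin N) : wordCol c r k < wordShape c r (r k) := by
  have h := wordCol_add_one (c := c) (r := r) k
  have h2 : #{k' : Fin N | (k : ℕ) ≤ k' ∧ r k' = r k} ≤ #{k' : Fin N | r k' = r k} :=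
    card_le_card fun x hx => by
      simp only [mem_filter, mem_univ, true_and] at hx ⊢
      exact hx.2
  rw [wordShape]
  omega

/-- Letters are read from the last index down, so this says that the lower of two boxes in a column
is added later. When it is added, the rows are weakly decreasing, so the higher row already reaches
that column. -/
theorem IsLatticeWord.lt_of_wordCol_eq (h : IsLatticeWord c r) {k k' : Fin N} (hne : k ≠ k')
    (he : wordCol c r k = wordCol c r k') (hr : r k' ≤ r k) : k < k' := by
  by_contra hlt
  have hlt' : k' < k := lt_of_le_of_ne (not_lt.mp hlt) hne.symm
  have h1 := h k hr
  simp only at h1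
  rw [← wordCol_add_one] at h1
  have h2 : #{x : Fin N | (k : ℕ) ≤ x ∧ r x = r k'} ≤ #{x : Fin N | k' < x ∧ r x = r k'} :=
    card_le_card fun x hx => by
      simp only [mem_filter, mem_univ, true_and, Fin.val_fin_le] at hx ⊢
      exact ⟨hlt'.trans_le hx.1, hx.2⟩
  rw [he, wordCol] at h1
  omega

theorem IsLatticeWord.eq_of_wordCol_eq (h : IsLatticeWord c r) {k k' : Fin N}
    (he : wordCol c r k = wordCol c r k') (hr : r k = r k') : k = k' := by
  by_contra hne
  exact (h.lt_of_wordCol_eq hne he hr.ge).not_gt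
    (h.lt_of_wordCol_eq (Ne.symm hne) he.symm hr.le)

/-- Letters read before `k` in its column occupy distinct rows above `r k`, and these rows are
disjoint from those whose initial boxes already cover the column. This becomes the bound on leading
exponents. -/
theorem IsLatticeWord.card_wordCol_eq_le (h : IsLatticeWord c r) (k : Fin N) :
    #{k' : Fin N | wordCol c r k' = wordCol c r k ∧ k < k'} +
      #{i ∈ range (r k) | wordCol c r k < c i} ≤ r k := by
  rw [← card_image_of_injOn (f := r), ← card_union_of_disjoint]
  · conv_rhs => rw [← card_range (r k)]
    refine card_le_card fun i hi => ?_
    rw [mem_union] at hi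
    rcases hi with hi | hi
    · obtain ⟨k', hk', rfl⟩ := mem_image.mp hi
      simp only [mem_filter, mem_univ, true_and] at hk'
      rw [mem_range]
      by_contra hr
      exact (h.lt_of_wordCol_eq hk'.2.ne' hk'.1 (not_lt.mp hr)).not_gt hk'.2
    · exact (mem_filter.mp hi).1
  · rw [disjoint_left]
    rintro i hi hi'
    obtain ⟨k', hk', rfl⟩ := mem_image.mp hi
    simp only [mem_filter, mem_univ, true_and] at hk' hi'
    have : c (r k') ≤ wordCol c r k' := Nat.le_add_right _ _
    omega
  · intro x hx y hy e
    simp only [coe_filter, mem_univ, true_and, Set.mem_ofPred_eq] at hx hy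
    exact h.eq_of_wordCol_eq (hx.1.trans hy.1.symm) e

theorem IsLatticeWord.exists_wordCol_eq (h : IsLatticeWord c r) {i x : ℕ} (h1 : c i ≤ x)
    (h2 : x < wordShape c r i) : ∃ k, r k = i ∧ wordCol c r k = x := by
  have him : ({k : Fin N | r k = i} : Finset (Fin N)).image (wordCol c r) =
      Ico (c i) (wordShape c r i) := by
    refine eq_of_subset_of_card_le ?_ ?_
    · intro y hy
      obtain ⟨k, hk, rfl⟩ := mem_image.mp hy
      obtain rfl : r k = i := by simpa using hk
      rw [mem_Ico]
      exact ⟨Nat.le_add_right _ _, wordCol_lt_wordShape k⟩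
    · rw [card_image_of_injOn, Nat.card_Ico, wordShape, Nat.add_sub_cancel_left]
      intro k hk k' hk' e
      simp only [coe_filter, mem_univ, true_and, Set.mem_ofPred_eq] at hk hk'
      exact h.eq_of_wordCol_eq e (hk.trans hk'.symm)
  have hx : x ∈ Ico (c i) (wordShape c r i) := mem_Ico.mpr ⟨h1, h2⟩
  rw [← him] at hx
  obtain ⟨k, hk, hkx⟩ := mem_image.mp hx
  exact ⟨k, by simpa using hk, hkx⟩

theorem IsLatticeWord.card_wordCol_eq (h : IsLatticeWord c r) {B : ℕ} (hB : wordShape c r B = 0)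
    (x : ℕ) : #{i ∈ range B | x < c i} + #{k : Fin N | wordCol c r k = x} =
      #{i ∈ range B | x < wordShape c r i} := by
  have hcard : #{k : Fin N | wordCol c r k = x} =
      #{i ∈ range B | c i ≤ x ∧ x < wordShape c r i} := by
    refine Finset.card_bij (fun k _ => r k) ?_ ?_ ?_
    · intro k hk
      obtain rfl : wordCol c r k = x := by simpa using hk
      simp only [mem_filter, mem_range]
      refine ⟨?_, Nat.le_add_right _ _, wordCol_lt_wordShape k⟩
      by_contra hlt
      have h1 := h.antitone_wordShape (not_lt.mp hlt)
      have h2 := wordCol_lt_wordShape (c := c) (r := r) k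
      omega
    · intro k hk k' hk' e
      simp only [mem_filter, mem_univ, true_and] at hk hk'
      exact h.eq_of_wordCol_eq (hk.trans hk'.symm) e
    · intro i hi
      simp only [mem_filter] at hi
      obtain ⟨k, hk, hkx⟩ := h.exists_wordCol_eq hi.2.1 hi.2.2
      exact ⟨k, by simpa using hkx, hk⟩
  rw [hcard, ← card_union_of_disjoint]
  · congr 1
    ext i
    have : c i ≤ wordShape c r i := Nat.le_add_right _ _
    simp only [mem_union, mem_filter]
    constructor
    · rintro (⟨h1, h2⟩ | ⟨h1, h2, h3⟩)
      · exact ⟨h1, by omega⟩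
      · exact ⟨h1, h3⟩
    · rintro ⟨h1, h2⟩
      by_cases h3 : x < c i
      · exact Or.inl ⟨h1, h3⟩
      · exact Or.inr ⟨h1, not_lt.mp h3, h2⟩
  · rw [disjoint_left]
    intro i h1 h2
    have h1 := (mem_filter.mp h1).2
    have h2 := (mem_filter.mp h2).2.1
    omega

theorem sum_wordShape {B : ℕ} (hr : ∀ k, r k < B) :
    ∑ i ∈ range B, wordShape c r i = ∑ i ∈ range B, c i + N := by
  have : N = ∑ i ∈ range B, #{k : Fin N | r k = i} := by
    conv_lhs => rw [← Fintype.card_fin N, ← card_univ]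
    exact card_eq_sum_card_fiberwise fun k _ => mem_coe.mpr (mem_range.mpr (hr k))
  simp only [wordShape]
  rw [sum_add_distrib, ← this]

theorem IsLatticeWord.lt_of_wordShape_eq_zero (h : IsLatticeWord c r) {B : ℕ}
    (hB : wordShape c r B = 0) (k : Fin N) : r k < B := by
  by_contra hlt
  have h1 := h.antitone_wordShape (not_lt.mp hlt)
  have h2 := wordCol_lt_wordShape (c := c) (r := r) k
  omega

end Words

/-! ### Nonvanishing points with prescribed multiplicities. -/

section Points

variable {K : Type*} [Field K] [DecidableEq K]

/-- A nonzero polynomial has a monomial dominating a lattice word whose shape is the list of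
multiplicities of the coordinates of a point where the polynomial does not vanish. Here every
value `x` is already present with multiplicity `M x`. -/
theorem exists_latticeWord_eval_ne_zero {c : ℕ → ℕ} (hc : Antitone c) {M : K → ℕ} {b : ℕ → K}
    (hb : Function.Injective b) (hM : ∀ i, M (b i) = c i) {N : ℕ} (f : MvPolynomial (Fin N) K)
    (hf : f ≠ 0) :
    ∃ u ∈ f.support, ∃ (r : Fin N → ℕ) (a : Fin N → K) (b' : ℕ → K), Function.Injective b' ∧
      eval a f ≠ 0 ∧ (∀ k, r k ≤ u k) ∧ IsLatticeWord c r ∧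
      ∀ i, M (b' i) + #{k | a k = b' i} = wordShape c r i := by
  induction N with
  | zero =>
    obtain ⟨u, hu⟩ := support_nonempty.mpr hf
    refine ⟨u, hu, Fin.elim0, Fin.elim0, b, hb, ?_, fun k => k.elim0, ?_, ?_⟩
    · rw [eq_C_of_isEmpty f] at hf ⊢
      rw [eval_C]
      exact fun h => hf (by rw [h, C_0])
    · intro j
      simpa using hc
    · intro i
      simp [wordShape, hM]
  | succ N ih =>
    let P := finSuccEquiv K N f
    have hP : P ≠ 0 := (EmbeddingLike.map_ne_zero_iff).mpr hf
    obtain ⟨u, hu, r, a, b', hb', ha, hr, hlat, hcount⟩ :=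
      ih P.leadingCoeff (Polynomial.leadingCoeff_ne_zero.mpr hP)
    let p := P.map (eval a)
    have hpc : p.coeff P.natDegree ≠ 0 := by
      rw [Polynomial.coeff_map]
      exact ha
    have hp : p ≠ 0 := fun h => hpc (by rw [h, Polynomial.coeff_zero])
    -- A nonzero polynomial of degree at most `d` cannot vanish at all of the `d + 1` distinct
    -- values `b' 0, …, b' d`.
    obtain ⟨i, hi, hroot⟩ : ∃ i ≤ P.natDegree, p.eval (b' i) ≠ 0 := by
      by_contra hcon
      push Not at hcon
      refine hp (Polynomial.eq_zero_of_natDegree_lt_card_of_eval_eq_zero p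
        (f := fun i : Fin (P.natDegree + 1) => b' i)
        (fun x y e => Fin.ext (hb' e)) (fun i => hcon i (Nat.lt_succ_iff.mp i.2)) ?_)
      rw [Fintype.card_fin]
      exact Nat.lt_succ_of_le Polynomial.natDegree_map_le
    have hex : ∃ t, wordShape c r t = wordShape c r i := ⟨i, rfl⟩
    -- A box added to row `i` might spoil the partition, so it goes to the topmost row `t` of the
    -- same length. Since `t ≤ i`, the exponent bound survives; swapping the values of rows `i` and
    -- `t` keeps the multiplicities matched.
    obtain ⟨t, ht, hmin⟩ : ∃ t, wordShape c r t = wordShape c r i ∧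
        ∀ s < t, wordShape c r s ≠ wordShape c r i :=
      ⟨Nat.find hex, Nat.find_spec hex, fun s hs => Nat.find_min hex hs⟩
    have hti : t ≤ i := by
      by_contra h
      exact hmin i (not_le.mp h) rfl
    refine ⟨u.cons P.natDegree, ?_, Fin.cons t r, Fin.cons (b' i) a, b' ∘ Equiv.swap i t,
      hb'.comp (Equiv.injective _), ?_, ?_, ?_, ?_⟩
    · exact mem_support_coeff_finSuccEquiv.mp hu
    · rw [eval_eq_eval_mv_eval']
      exact hroot
    · intro k
      refine Fin.cases ?_ (fun k => ?_) k
      · simpa using hti.trans hi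
      · simpa using hr k
    · intro j
      rcases j with _ | j
      · refine antitone_nat_of_succ_le fun s => ?_
        have h1 := hlat.antitone_wordShape (Nat.le_add_right s 1)
        simp only [wordShape] at h1 ht hmin
        simp only [Fin.card_filter_univ_succ', Fin.cons_zero, Fin.cons_succ, Nat.zero_le, true_and]
        have h2 := hmin s
        split_ifs with h3 h4 h4
        · omega
        · subst h3
          have := h2 (by omega)
          omega
        · omega
        · omega
      · have := hlat j
        simpa [Fin.card_filter_univ_succ', Function.comp_def] using this
    · intro s
      have h1 := hcount (Equiv.swap i t s)
      have h2 : wordShape c r (Equiv.swap i t s) = wordShape c r s := by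
        rcases eq_or_ne s i with rfl | hsi
        · rw [Equiv.swap_apply_left, ht]
        · rcases eq_or_ne s t with rfl | hst
          · rw [Equiv.swap_apply_right, ht]
          · rw [Equiv.swap_apply_of_ne_of_ne hsi hst]
      have h3 : b' i = b' (Equiv.swap i t s) ↔ t = s := by
        rw [hb'.eq_iff, ← Equiv.swap_apply_eq_iff, Equiv.swap_apply_left]
      rw [h2] at h1
      simp only [wordShape] at h1 ⊢
      simp only [Fin.card_filter_univ_succ', Fin.cons_zero, Function.comp_def, Fin.cons_succ, h3]
      omega

end Points

/-! ### Pigeonhole bounds on multiplicities of values. -/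

section Pigeonhole

/-- Column `x` has `min j (μ.colLen x)` boxes in the first `j` rows; count these boxes by columns
and by rows. -/
theorem YoungDiagram.sum_le_sum_rowLen (μ : YoungDiagram) {j : ℕ} {h : ℕ → ℕ}
    (h1 : ∀ x, h x ≤ j) (h2 : ∀ x, h x ≤ μ.colLen x) :
    ∑ x ∈ range (μ.rowLen 0), h x ≤ ∑ i ∈ range j, μ.rowLen i := by
  calc ∑ x ∈ range (μ.rowLen 0), h x
      ≤ ∑ x ∈ range (μ.rowLen 0), #{i ∈ range j | x < μ.rowLen i} := by
        refine sum_le_sum fun x _ => ?_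
        rw [← card_range (h x)]
        refine card_le_card fun i hi => ?_
        rw [mem_range] at hi
        rw [mem_filter, mem_range, ← YoungDiagram.mem_iff_lt_rowLen,
          YoungDiagram.mem_iff_lt_colLen]
        exact ⟨hi.trans_le (h1 x), hi.trans_le (h2 x)⟩
    _ = ∑ i ∈ range j, #{x ∈ range (μ.rowLen 0) | x < μ.rowLen i} := by
        simp only [card_filter]
        exact sum_comm
    _ = ∑ i ∈ range j, μ.rowLen i := by
        refine sum_congr rfl fun i _ => ?_
        conv_rhs => rw [← card_range (μ.rowLen i)]
        congr 1
        ext x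
        have := μ.rowLen_anti 0 i (Nat.zero_le _)
        simp only [mem_filter, mem_range]
        omega

variable {K : Type*} [DecidableEq K] {n l : ℕ} [NeZero n] {μ : YoungDiagram}
  {C : ℕ → Finset (Fin n)}

theorem IsColumnFamily.sum_card_filter (hC : IsColumnFamily l μ C) (P : Fin n → Prop)
    [DecidablePred P] :
    ∑ x ∈ range (μ.rowLen 0), #{i ∈ C x | i ≠ 0 ∧ P i} = #{i | i ≠ 0 ∧ P i} := by
  calc ∑ x ∈ range (μ.rowLen 0), #{i ∈ C x | i ≠ 0 ∧ P i}
      = ∑ x ∈ range (μ.rowLen 0), ∑ i with i ≠ 0 ∧ P i, if i ∈ C x then 1 else 0 := by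
        refine sum_congr rfl fun x _ => ?_
        rw [← card_filter, filter_filter]
        congr 1
        ext i
        simp only [mem_filter, mem_univ, true_and]
        tauto
    _ = ∑ i with i ≠ 0 ∧ P i, #{x ∈ range (μ.rowLen 0) | i ∈ C x} := by
        rw [sum_comm]
        simp only [card_filter]
    _ = #{i | i ≠ 0 ∧ P i} := by
        rw [card_eq_sum_ones]
        exact sum_congr rfl fun i hi => hC.card_ne_zero i (mem_filter.mp hi).2.1

theorem card_filter_mem_le {α : Type*} {s : Finset α} {a : α → K} (ha : Set.InjOn a s)
    (S : Finset K) : #{i ∈ s | a i ∈ S} ≤ #S :=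
  card_le_card_of_injOn a (fun _ hi => (mem_filter.mp hi).2)
    (ha.mono fun _ hi => (mem_filter.mp hi).1)

/-- The values in one column are distinct, so it contains at most `#S` entries with value in `S`.
This is the source of dominance by `μ`. -/
theorem IsColumnFamily.card_add_le_of_injOn (hC : IsColumnFamily l μ C) {a : Fin n → K}
    (ha : ∀ x, Set.InjOn a (C x)) (S : Finset K) :
    #{i | i ≠ 0 ∧ a i ∈ S} + (if a 0 ∈ S then l else 0) ≤ ∑ i ∈ range #S, μ.rowLen i := by
  refine le_trans (le_of_eq ?_) (μ.sum_le_sum_rowLen (h := fun x => #{i ∈ C x | a i ∈ S})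
    (fun x => card_filter_mem_le (ha x) S) fun x => (card_filter_le _ _).trans (hC.card_eq x).le)
  rw [← hC.sum_card_filter, ← hC.card_zero]
  have : (if a 0 ∈ S then #{j ∈ range (μ.rowLen 0) | 0 ∈ C j} else 0) =
      ∑ x ∈ range (μ.rowLen 0), if 0 ∈ C x ∧ a 0 ∈ S then 1 else 0 := by
    rw [← card_filter]
    split_ifs with h <;> simp [h]
  rw [this, ← sum_add_distrib]
  refine sum_congr rfl fun x _ => ?_
  by_cases h : 0 ∈ C x ∧ a 0 ∈ S
  · rw [if_pos h, ← card_insert_of_notMem (a := 0) (by simp)]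
    congr 1
    ext i
    simp only [mem_insert, mem_filter]
    by_cases hi : i = 0
    · subst hi
      simp [h]
    · simp [hi]
  · rw [if_neg h, add_zero]
    congr 1
    ext i
    simp only [mem_filter]
    constructor
    · tauto
    · rintro ⟨h1, h2⟩
      refine ⟨h1, ?_, h2⟩
      rintro rfl
      exact h ⟨h1, h2⟩

variable {a : Fin n → K}

theorem card_filter_ne_zero_le (ha : ∀ x, Set.InjOn a ((C x).erase 0 : Finset (Fin n)))
    (S : Finset K) (x : ℕ) : #{i ∈ C x | i ≠ 0 ∧ a i ∈ S} ≤ #S := by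
  refine le_trans (card_le_card fun i hi => ?_) (card_filter_mem_le (ha x) S)
  simp only [mem_filter, mem_erase] at hi ⊢
  tauto

theorem IsColumnFamily.card_le (hC : IsColumnFamily l μ C)
    (ha : ∀ x, Set.InjOn a ((C x).erase 0 : Finset (Fin n))) (S : Finset K) :
    #{i | i ≠ 0 ∧ a i ∈ S} ≤ ∑ i ∈ range #S, μ.rowLen i := by
  rw [← hC.sum_card_filter]
  exact μ.sum_le_sum_rowLen (card_filter_ne_zero_le ha S)
    fun x => (card_filter_le _ _).trans (hC.card_eq x).le

theorem IsColumnFamily.card_filter_add_le (hC : IsColumnFamily l μ C) (P : Fin n → Prop)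
    [DecidablePred P] (x : ℕ) :
    #{i ∈ C x | i ≠ 0 ∧ P i} + (if 0 ∈ C x then 1 else 0) ≤ μ.colLen x := by
  rw [← hC.card_eq]
  split_ifs with h
  · rw [← card_erase_add_one h]
    gcongr
    intro i hi
    rw [mem_filter] at hi
    exact mem_erase.mpr ⟨hi.2.1, hi.1⟩
  · exact card_filter_le _ _

/-- Here the entry `0` has no value, so it may raise the count in its column to `#S + 1`, at the
price of one more row. -/
theorem IsColumnFamily.card_add_le_succ (hC : IsColumnFamily l μ C)
    (ha : ∀ x, Set.InjOn a ((C x).erase 0 : Finset (Fin n))) (S : Finset K) :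
    #{i | i ≠ 0 ∧ a i ∈ S} + l ≤ ∑ i ∈ range (#S + 1), μ.rowLen i := by
  rw [← hC.sum_card_filter, ← hC.card_zero, card_filter, ← sum_add_distrib]
  refine μ.sum_le_sum_rowLen (fun x => ?_) (hC.card_filter_add_le _)
  have := card_filter_ne_zero_le ha S x
  split_ifs <;> omega

/-- A column with `0` but without the value `v ∈ S` has at most `#S - 1` other entries with value in
`S`. Only columns containing both can exceed `#S`, and by at most one; the inequality bounds their
number from below. -/
theorem IsColumnFamily.card_add_le_add (hC : IsColumnFamily l μ C)
    (ha : ∀ x, Set.InjOn a ((C x).erase 0 : Finset (Fin n))) (S : Finset K) {v : K} (hv : v ∈ S) :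
    #{i | i ≠ 0 ∧ a i ∈ S} + l ≤ ∑ i ∈ range #S, μ.rowLen i +
      #{x ∈ range (μ.rowLen 0) | 0 ∈ C x ∧ ∃ i ∈ C x, i ≠ 0 ∧ a i = v} := by
  rw [← hC.sum_card_filter, ← hC.card_zero, card_filter, card_filter, ← sum_add_distrib]
  refine (sum_le_sum fun x _ => le_tsub_add (a :=
    if 0 ∈ C x ∧ ∃ i ∈ C x, i ≠ 0 ∧ a i = v then 1 else 0)).trans ?_
  rw [sum_add_distrib]
  refine Nat.add_le_add_right ?_ _
  refine μ.sum_le_sum_rowLen (fun x => ?_) fun x =>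
    (Nat.sub_le _ _).trans (hC.card_filter_add_le _ x)
  have h1 := card_filter_ne_zero_le ha S x
  by_cases h0 : 0 ∈ C x
  · by_cases h : ∃ i ∈ C x, i ≠ 0 ∧ a i = v
    · rw [if_pos h0, if_pos ⟨h0, h⟩]
      omega
    · have h2 := card_filter_ne_zero_le ha (S.erase v) x
      rw [card_erase_of_mem hv] at h2
      have h3 : ({i ∈ C x | i ≠ 0 ∧ a i ∈ S.erase v} : Finset (Fin n)) =
          {i ∈ C x | i ≠ 0 ∧ a i ∈ S} := by
        refine filter_congr fun i hi => and_congr_right fun hi0 => ?_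
        rw [mem_erase, and_iff_right_iff_imp]
        exact fun _ e => h ⟨i, hi, hi0, e⟩
      have h4 := card_pos.mpr ⟨v, hv⟩
      rw [h3] at h2
      rw [if_pos h0]
      omega
  · rw [if_neg h0]
    omega

end Pigeonhole

/-! ### Horizontal strips with prescribed defects. -/

section Strip

/-- The number of boxes of the optimal horizontal strip below row `k`. -/
def stripDefect (ν μ : ℕ → ℕ) (l J k : ℕ) : ℕ :=
  (range J).sup fun j =>
    (if k ≤ j then ∑ i ∈ range (j + 1), ν i else ∑ i ∈ range j, ν i + ν k) + l -
      ∑ i ∈ range (j + 1), μ i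

variable {ν μ : ℕ → ℕ} {l J : ℕ}

/-- For antitone `ν`, the bracket in `stripDefect` is the largest sum of `j + 1` rows among which is
row `k`. Passing to row `k + 1` cannot increase it, which makes the rows of the strip nonnegative.
-/
theorem stripDefect_succ_le (hν : Antitone ν) (k : ℕ) :
    stripDefect ν μ l J (k + 1) ≤ stripDefect ν μ l J k := by
  refine sup_mono_fun fun j _ => ?_
  have h1 := hν (Nat.le_add_right k 1)
  refine Nat.sub_le_sub_right (Nat.add_le_add_right ?_ l) _
  split_ifs with h2 h3 h3
  · exact le_rfl
  · omega
  · obtain rfl : k = j := by omega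
    rw [sum_range_succ]
    omega
  · omega

/-- Passing from row `k` to row `k + 1` lowers each bracket by at most `ν k - ν (k + 1)`; this is
what makes the strip horizontal. -/
theorem stripDefect_add_le (hν : Antitone ν) (k : ℕ) :
    stripDefect ν μ l J k + ν (k + 1) ≤ stripDefect ν μ l J (k + 1) + ν k := by
  have h1 := hν (Nat.le_add_right k 1)
  suffices stripDefect ν μ l J k ≤ stripDefect ν μ l J (k + 1) + (ν k - ν (k + 1)) by omega
  refine Finset.sup_le fun j hj => ?_
  refine le_trans ?_ (Nat.add_le_add_right (le_sup (f := fun j =>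
    (if k + 1 ≤ j then ∑ i ∈ range (j + 1), ν i else ∑ i ∈ range j, ν i + ν (k + 1)) + l -
      ∑ i ∈ range (j + 1), μ i) hj) _)
  split_ifs with h2 h3 h3
  · omega
  · obtain rfl : k = j := by omega
    rw [sum_range_succ]
    omega
  · omega
  · omega

/-- Place exactly `stripDefect ν μ l J k` of the `l` boxes below each row `k`. Dominance through row
`k < J` is the term `j = k` of the supremum, and through later rows it is `h2`. The last sum is
summation by parts. -/
theorem exists_horizontalStrip (hν : Antitone ν) (hJ : ν J = 0)
    (h1 : ∀ j, ∑ i ∈ range j, ν i ≤ ∑ i ∈ range j, μ i)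
    (h2 : ∀ j, ∑ i ∈ range j, ν i + l ≤ ∑ i ∈ range (j + 1), μ i) :
    ∃ ρ : ℕ → ℕ, (∀ i, ν i ≤ ρ i) ∧ (∀ i, ρ (i + 1) ≤ ν i) ∧
      (∀ k, ∑ i ∈ range k, ρ i ≤ ∑ i ∈ range k, μ i) ∧
      ∑ i ∈ range (J + 1), (ρ i - ν i) = l ∧
      ∑ i ∈ range (J + 1), (ρ i - ν i) * i = ∑ k ∈ range J, stripDefect ν μ l J k := by
  have hν0 : ∀ k, J ≤ k → ν k = 0 := fun k hk => by
    have := hν hk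
    omega
  let D := stripDefect ν μ l J
  have hD1 : ∀ k, D (k + 1) ≤ D k := stripDefect_succ_le hν
  have hD2 : ∀ k, D k + ν (k + 1) ≤ D (k + 1) + ν k := stripDefect_add_le hν
  have hD0 : D 0 ≤ l := by
    refine Finset.sup_le fun j _ => ?_
    rw [if_pos (Nat.zero_le _)]
    have := h1 (j + 1)
    omega
  have hDJ : ∀ k, J ≤ k → D k = 0 := by
    intro k hk
    refine Nat.le_zero.mp (Finset.sup_le fun j hj => ?_)
    rw [mem_range] at hj
    rw [if_neg (by omega), hν0 k hk]
    have := h2 j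
    omega
  have hDk : ∀ k, ∑ i ∈ range (k + 1), ν i + l ≤ ∑ i ∈ range (k + 1), μ i + D k := by
    intro k
    by_cases hk : k < J
    · have := le_sup (f := fun j =>
        (if k ≤ j then ∑ i ∈ range (j + 1), ν i else ∑ i ∈ range j, ν i + ν k) + l -
          ∑ i ∈ range (j + 1), μ i) (mem_range.mpr hk)
      simp only [le_refl, if_true] at this
      change _ ≤ D k at this
      omega
    · have := h2 k
      rw [sum_range_succ, hν0 k (not_lt.mp hk)]
      omega
  let e : ℕ → ℕ := fun i => Nat.casesOn i (l - D 0) fun k => D k - D (k + 1)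
  have he0 : e 0 = l - D 0 := rfl
  have hes : ∀ k, e (k + 1) = D k - D (k + 1) := fun _ => rfl
  have hsum : ∀ k, ∑ i ∈ range (k + 1), e i + D k = l := by
    intro k
    induction k with
    | zero =>
      rw [sum_range_one, he0]
      omega
    | succ k ih =>
      rw [sum_range_succ, hes]
      have := hD1 k
      omega
  have hsum2 : ∀ k, ∑ i ∈ range (k + 1), e i * i + D k * k = ∑ i ∈ range k, D i := by
    intro k
    induction k with
    | zero => simp
    | succ k ih =>
      rw [sum_range_succ, hes, sum_range_succ D, ← ih]
      obtain ⟨t, ht⟩ := Nat.exists_eq_add_of_le (hD1 k)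
      rw [ht, Nat.add_sub_cancel_left]
      ring
  refine ⟨fun i => ν i + e i, fun i => Nat.le_add_right _ _, fun i => ?_, fun k => ?_, ?_, ?_⟩
  · have := hD2 i
    have := hD1 i
    simp only [hes]
    omega
  · rcases k with _ | k
    · simp
    · have := hsum k
      have := hDk k
      rw [sum_add_distrib]
      omega
  · have := hsum J
    rw [hDJ J le_rfl] at this
    simpa using this
  · have := hsum2 J
    rw [hDJ J le_rfl] at this
    simpa using this

end Strip

/-! ### Specializing elements of the Specht ideal. -/

section Evaluation

variable {K : Type*} [Field K] {n l : ℕ} [NeZero n] {μ : YoungDiagram}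

theorem exists_columnFamily_map_ne_zero {R : Type*} [CommRing R]
    (ψ : MvPolynomial (Fin n) K →+* R) {f : MvPolynomial (Fin n) K}
    (hf : f ∈ spechtIdeal K n l μ) (h0 : ψ f ≠ 0) :
    ∃ C, IsColumnFamily l μ C ∧ ψ (columnsPoly K μ C) ≠ 0 := by
  by_contra hcon
  push Not at hcon
  rw [spechtIdeal_eq_span_columnsPoly] at hf
  have hle : Ideal.span {f | ∃ C, IsColumnFamily l μ C ∧ f = columnsPoly K μ C} ≤
      RingHom.ker ψ := by
    rw [Ideal.span_le]
    rintro _ ⟨C, hC, rfl⟩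
    exact hcon C hC
  exact h0 (hle hf)

theorem IsColumnFamily.map_X_ne_of_map_ne_zero {R : Type*} [CommRing R]
    {C : ℕ → Finset (Fin n)} (hC : IsColumnFamily l μ C) (ψ : MvPolynomial (Fin n) K →+* R)
    (h : ψ (columnsPoly K μ C) ≠ 0) (x : ℕ) : Set.InjOn (fun i => ψ (X i)) (C x) := by
  have hx : x ∈ range (μ.rowLen 0) ∨ C x = ∅ := by
    rw [mem_range]
    exact (lt_or_ge x (μ.rowLen 0)).imp id hC.eq_empty
  rcases hx with hx | hx
  swap
  · simp [hx]
  have key : ∀ i ∈ C x, ∀ j ∈ C x, i < j → ψ (X i) ≠ ψ (X j) := by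
    intro i hi j hj hij e
    apply h
    rw [columnsPoly, map_prod]
    refine prod_eq_zero hx ?_
    rw [diffProd, map_prod]
    refine prod_eq_zero (i := (i, j)) (by simp [hi, hj, hij]) ?_
    rw [map_sub, e, sub_self]
  intro i hi j hj e
  by_contra hne
  rcases lt_or_gt_of_ne hne with hlt | hlt
  · exact key i hi j hj hlt e
  · exact key j hj i hi hlt e.symm

theorem exists_columnFamily_injOn_of_eval_ne_zero {f : MvPolynomial (Fin n) K}
    (hf : f ∈ spechtIdeal K n l μ) {a : Fin n → K} (h0 : eval a f ≠ 0) :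
    ∃ C : ℕ → Finset (Fin n), IsColumnFamily l μ C ∧ ∀ x, Set.InjOn a (C x) := by
  obtain ⟨C, hC, h⟩ := exists_columnFamily_map_ne_zero (eval a) hf h0
  refine ⟨C, hC, fun x => ?_⟩
  have := hC.map_X_ne_of_map_ne_zero (eval a) h x
  simpa using this

/-- Substitution of the values `a i` for all variables but the one of index `0`. -/
def evalExceptZero (a : Fin n → K) : MvPolynomial (Fin n) K →ₐ[K] Polynomial K :=
  aeval fun i => if i = 0 then Polynomial.X else Polynomial.C (a i)

theorem evalExceptZero_X_zero (a : Fin n → K) : evalExceptZero a (X 0) = Polynomial.X := by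
  simp [evalExceptZero]

theorem evalExceptZero_X_of_ne (a : Fin n → K) {i : Fin n} (hi : i ≠ 0) :
    evalExceptZero a (X i) = Polynomial.C (a i) := by
  simp [evalExceptZero, hi]

theorem IsColumnFamily.injOn_of_evalExceptZero_ne_zero {C : ℕ → Finset (Fin n)}
    (hC : IsColumnFamily l μ C) {a : Fin n → K} (h : evalExceptZero a (columnsPoly K μ C) ≠ 0)
    (x : ℕ) : Set.InjOn a ((C x).erase 0 : Finset (Fin n)) := by
  have := hC.map_X_ne_of_map_ne_zero (evalExceptZero a).toRingHom h x
  intro i hi j hj e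
  rw [mem_coe, mem_erase] at hi hj
  refine this hi.2 hj.2 ?_
  change evalExceptZero a (X i) = evalExceptZero a (X j)
  rw [evalExceptZero_X_of_ne a hi.1, evalExceptZero_X_of_ne a hj.1, e]

/-- A generator surviving the substitution is injective on nonzero entries of each column, and every
column with both `0` and an entry of value `v` supplies a factor `X - v`. -/
theorem pow_dvd_evalExceptZero [DecidableEq K] {f : MvPolynomial (Fin n) K} (hf : f ∈ spechtIdeal K n l μ)
    (a : Fin n → K) (v : K) (D : ℕ) (hD : ∀ C, IsColumnFamily l μ C →
      (∀ x, Set.InjOn a ((C x).erase 0 : Finset (Fin n))) →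
      D ≤ #{x ∈ range (μ.rowLen 0) | 0 ∈ C x ∧ ∃ i ∈ C x, i ≠ 0 ∧ a i = v}) :
    (Polynomial.X - Polynomial.C v) ^ D ∣ evalExceptZero a f := by
  rw [spechtIdeal_eq_span_columnsPoly] at hf
  suffices Ideal.span {f | ∃ C, IsColumnFamily l μ C ∧ f = columnsPoly K μ C} ≤
      (Ideal.span {(Polynomial.X - Polynomial.C v) ^ D}).comap (evalExceptZero a) from
    Ideal.mem_span_singleton.mp (this hf)
  rw [Ideal.span_le]
  rintro _ ⟨C, hC, rfl⟩
  rw [SetLike.mem_coe, Ideal.mem_comap, Ideal.mem_span_singleton]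
  by_cases h : evalExceptZero a (columnsPoly K μ C) = 0
  · rw [h]
    exact dvd_zero _
  have hinj := hC.injOn_of_evalExceptZero_ne_zero h
  refine (pow_dvd_pow _ (hD C hC hinj)).trans ?_
  rw [columnsPoly, map_prod, ← prod_const]
  refine (prod_dvd_prod_of_dvd _ (fun x => evalExceptZero a (diffProd K (C x))) ?_).trans
    (prod_dvd_prod_of_subset _ _ _ (filter_subset _ _))
  intro x hx
  obtain ⟨-, h0, i, hi, hi0, rfl⟩ := mem_filter.mp hx
  rw [diffProd, map_prod]
  have hmem : ((0 : Fin n), i) ∈ (C x ×ˢ C x).filter fun p => p.1 < p.2 := by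
    rw [mem_filter, mem_product]
    exact ⟨⟨h0, hi⟩, Fin.pos_iff_ne_zero.mpr hi0⟩
  refine dvd_trans ?_ (dvd_prod_of_mem _ hmem)
  rw [map_sub, evalExceptZero_X_zero, evalExceptZero_X_of_ne a hi0]

theorem sum_le_natDegree_of_pow_dvd {p : Polynomial K} (hp : p ≠ 0) {b : ℕ → K}
    (hb : Function.Injective b) {D : ℕ → ℕ} {J : ℕ}
    (h : ∀ k < J, (Polynomial.X - Polynomial.C (b k)) ^ D k ∣ p) :
    ∑ k ∈ range J, D k ≤ p.natDegree := by
  have hdvd : ∏ k ∈ range J, (Polynomial.X - Polynomial.C (b k)) ^ D k ∣ p := by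
    refine prod_dvd_of_coprime (fun i _ j _ hij => ?_) fun k hk => h k (mem_range.mp hk)
    exact (Polynomial.pairwise_coprime_X_sub_C hb hij).pow
  refine le_trans (le_of_eq ?_) (Polynomial.natDegree_le_of_dvd hdvd hp)
  rw [Polynomial.natDegree_prod_of_monic _ _ fun k _ => (Polynomial.monic_X_sub_C _).pow _]
  refine sum_congr rfl fun k _ => ?_
  rw [(Polynomial.monic_X_sub_C _).natDegree_pow, Polynomial.natDegree_X_sub_C, mul_one]

end Evaluation

/-! ### Tableaux built from lattice words. -/

section WordTableaux

variable {N : ℕ} {c : ℕ → ℕ} {r : Fin N → ℕ} {e : Fin (N + 1) ≃ Fin (N + 1)} {Z : Finset ℕ}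

/-- The columns of the tableau in which the letter `k` of a word contributes the entry
`e k.succ` and the entry `0` is in the columns in `Z`. -/
def wordColumns (c : ℕ → ℕ) (r : Fin N → ℕ) (e : Fin (N + 1) ≃ Fin (N + 1)) (Z : Finset ℕ)
    (x : ℕ) : Finset (Fin (N + 1)) :=
  (univ.filter fun k : Fin N => wordCol c r k = x).image (fun k => e k.succ) ∪
    if x ∈ Z then {0} else ∅

theorem zero_mem_wordColumns (he : e 0 = 0) (x : ℕ) : 0 ∈ wordColumns c r e Z x ↔ x ∈ Z := by
  have h : ∀ k : Fin N, e k.succ ≠ 0 := fun k h =>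
    Fin.succ_ne_zero k (e.injective (h.trans he.symm))
  by_cases hx : x ∈ Z <;> simp [wordColumns, hx, h]

theorem succ_mem_wordColumns (he : e 0 = 0) (k : Fin N) (x : ℕ) :
    e k.succ ∈ wordColumns c r e Z x ↔ wordCol c r k = x := by
  have h : e k.succ ≠ 0 := fun h => Fin.succ_ne_zero k (e.injective (h.trans he.symm))
  by_cases hx : x ∈ Z <;> simp [wordColumns, hx, h]

theorem card_filter_succ (he : e 0 = 0) (P : Fin (N + 1) → Prop) [DecidablePred P] :
    #{i | i ≠ 0 ∧ P i} = #{k : Fin N | P (e k.succ)} := by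
  symm
  refine Finset.card_bij (fun k _ => e k.succ) ?_ ?_ ?_
  · intro k hk
    simp only [mem_filter, mem_univ, true_and] at hk ⊢
    exact ⟨fun h => Fin.succ_ne_zero k (e.injective (h.trans he.symm)), hk⟩
  · intro k _ k' _ h
    exact Fin.succ_injective _ (e.injective h)
  · intro i hi
    simp only [mem_filter, mem_univ, true_and] at hi
    obtain ⟨k, hk⟩ := Fin.exists_succ_eq.mpr fun h : e.symm i = 0 =>
      hi.1 (by rw [← he, ← h, e.apply_symm_apply])
    have hk' : e k.succ = i := by rw [hk, e.apply_symm_apply]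
    exact ⟨k, by simpa [hk'] using hi.2, hk'⟩

theorem card_filter_wordColumns (he : e 0 = 0) (P : Fin (N + 1) → Prop) [DecidablePred P]
    (x : ℕ) : #{i ∈ wordColumns c r e Z x | P i} =
      #{k : Fin N | wordCol c r k = x ∧ P (e k.succ)} + if x ∈ Z ∧ P 0 then 1 else 0 := by
  have h1 : #{i ∈ wordColumns c r e Z x | i ≠ 0 ∧ P i} =
      #{k : Fin N | wordCol c r k = x ∧ P (e k.succ)} := by
    have := card_filter_succ he fun i => i ∈ wordColumns c r e Z x ∧ P i
    simp only [succ_mem_wordColumns he] at this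
    rw [← this]
    congr 1
    ext i
    simp only [mem_filter, mem_univ, true_and]
    tauto
  rw [← h1]
  by_cases h : x ∈ Z ∧ P 0
  · rw [if_pos h, ← card_insert_of_notMem (a := 0) (by simp)]
    congr 1
    ext i
    simp only [mem_insert, mem_filter]
    by_cases hi : i = 0
    · subst hi
      simp [h, zero_mem_wordColumns he]
    · simp [hi]
  · rw [if_neg h, add_zero]
    congr 1
    ext i
    simp only [mem_filter]
    constructor
    · rintro ⟨h1, h2⟩
      refine ⟨h1, ?_, h2⟩
      rintro rfl
      exact h ⟨(zero_mem_wordColumns he x).mp h1, h2⟩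
    · tauto

theorem isColumnFamily_wordColumns (he : e 0 = 0) {ρ : YoungDiagram}
    (hcol : ∀ x, ρ.colLen x = #{k : Fin N | wordCol c r k = x} + if x ∈ Z then 1 else 0) :
    IsColumnFamily #Z ρ (wordColumns c r e Z) := by
  have hlt : ∀ x, ρ.colLen x ≠ 0 → x < ρ.rowLen 0 := fun x hx => by
    by_contra h
    exact hx (ρ.colLen_eq_zero_of_le (not_lt.mp h))
  refine ⟨fun x => ?_, ?_, fun i hi => ?_⟩
  · have := card_filter_wordColumns (c := c) (r := r) (Z := Z) he (fun _ => True) x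
    simp only [and_true, filter_true] at this
    rw [this, hcol]
  · congr 1
    ext x
    simp only [mem_filter, mem_range, zero_mem_wordColumns he, and_iff_right_iff_imp]
    intro hx
    refine hlt x ?_
    rw [hcol, if_pos hx]
    omega
  · obtain ⟨k, hk⟩ := Fin.exists_succ_eq.mpr fun h : e.symm i = 0 =>
      hi (by rw [← he, ← h, e.apply_symm_apply])
    obtain rfl : e k.succ = i := by rw [hk, e.apply_symm_apply]
    rw [card_eq_one]
    refine ⟨wordCol c r k, ?_⟩
    ext x
    simp only [mem_filter, mem_range, succ_mem_wordColumns he, mem_singleton]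
    constructor
    · exact fun h => h.2.symm
    · rintro rfl
      refine ⟨hlt _ ?_, rfl⟩
      have : 0 < #{k' : Fin N | wordCol c r k' = wordCol c r k} := card_pos.mpr ⟨k, by simp⟩
      rw [hcol]
      omega

variable {K : Type*} [Field K] {m : MonomialOrder (Fin (N + 1))}

/-- Smaller variables in the column of letter `k` come from letters read before it, hence from rows
above `r k`. If the entry `0` is also smaller, `hZ` provides an initial box above to account for it.
-/
theorem degree_wordColumns_succ_le (he : e 0 = 0)
    (hm : ∀ k k' : Fin N, k < k' →
      m.toSyn (Finsupp.single (e k'.succ) 1) < m.toSyn (Finsupp.single (e k.succ) 1))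
    (hr : IsLatticeWord c r) (ρ : YoungDiagram) (k : Fin N)
    (hZ : wordCol c r k ∈ Z →
      m.toSyn (Finsupp.single 0 1) < m.toSyn (Finsupp.single (e k.succ) 1) →
      ∃ i < r k, wordCol c r k < c i) :
    m.degree (columnsPoly K ρ (wordColumns c r e Z)) (e k.succ) ≤ r k := by
  refine (degree_columnsPoly_apply_le m ρ _ _).trans ?_
  have hsub : {j ∈ range (ρ.rowLen 0) | e k.succ ∈ wordColumns c r e Z j} ⊆
      {wordCol c r k} := by
    intro x hx
    rw [mem_filter, succ_mem_wordColumns he] at hx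
    exact mem_singleton.mpr hx.2.symm
  refine (sum_le_sum_of_subset hsub).trans ?_
  rw [sum_singleton, card_filter_wordColumns he]
  refine le_trans ?_ (hr.card_wordCol_eq_le k)
  refine Nat.add_le_add (card_le_card fun k' hk' => ?_) ?_
  · simp only [mem_filter, mem_univ, true_and] at hk' ⊢
    refine ⟨hk'.1, ?_⟩
    by_contra hlt
    rcases eq_or_lt_of_le (not_lt.mp hlt) with h | h
    · rw [h] at hk'
      exact hk'.2.false
    · exact (hm k' k h).not_gt hk'.2
  · split_ifs with h
    · obtain ⟨i, hi, hi'⟩ := hZ h.1 h.2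
      exact card_pos.mpr ⟨i, by simp [hi, hi']⟩
    · exact Nat.zero_le _

theorem degree_wordColumns_zero_le (he : e 0 = 0) (ρ : YoungDiagram) :
    m.degree (columnsPoly K ρ (wordColumns c r e Z)) 0 ≤ ∑ x ∈ Z, #{k : Fin N |
      wordCol c r k = x ∧
        m.toSyn (Finsupp.single (e k.succ) 1) < m.toSyn (Finsupp.single 0 1)} := by
  refine (degree_columnsPoly_apply_le m ρ _ _).trans ?_
  have hsub : {j ∈ range (ρ.rowLen 0) | 0 ∈ wordColumns c r e Z j} ⊆ Z := by
    intro x hx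
    rw [mem_filter, zero_mem_wordColumns he] at hx
    exact hx.2
  refine (sum_le_sum_of_subset hsub).trans (sum_le_sum fun x _ => ?_)
  rw [card_filter_wordColumns he]
  simp

end WordTableaux

/-! ### Ordering the variables other than the repeated one. -/

section Sorting

/-- Words are read from the last letter, so a decreasing list makes smaller variables enter the
tableau first. -/
theorem exists_equiv_sorting {N : ℕ} (m : MonomialOrder (Fin (N + 1))) :
    ∃ e : Fin (N + 1) ≃ Fin (N + 1), e 0 = 0 ∧ ∀ k k' : Fin N, k < k' →
      m.toSyn (Finsupp.single (e k'.succ) 1) < m.toSyn (Finsupp.single (e k.succ) 1) := by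
  let g : Fin N → (m.syn)ᵒᵈ := fun k => OrderDual.toDual (m.toSyn (Finsupp.single k.succ 1))
  have hg : Function.Injective g := fun k k' h =>
    Fin.succ_injective _ (m.toSyn_single_injective (OrderDual.toDual.injective h))
  have hmono : StrictMono (g ∘ Tuple.sort g) :=
    (Tuple.monotone_sort g).strictMono_of_injective (hg.comp (Equiv.injective _))
  refine ⟨Equiv.Perm.decomposeFin.symm (0, Tuple.sort g), by simp, fun k k' h => ?_⟩
  have := hmono h
  simpa [g] using this

theorem exists_wordShape_eq_zero {N : ℕ} {c : ℕ → ℕ} (hc : Antitone c) (hc1 : c 1 = 0)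
    (r : Fin N → ℕ) : ∃ B, 0 < B ∧ wordShape c r B = 0 := by
  refine ⟨univ.sup r + 1, Nat.succ_pos _, ?_⟩
  have h1 : c (univ.sup r + 1) = 0 := by
    have := hc (Nat.le_add_left 1 (univ.sup r))
    omega
  rw [wordShape, h1, zero_add, card_eq_zero, filter_eq_empty_iff]
  intro k _ h
  have := le_sup (f := r) (mem_univ k)
  omega

end Sorting

/-! ### Monomials divisible by leading monomials of Specht polynomials. -/

section InitialMonomials

variable {K : Type*} [Field K] {N l : ℕ} {μ ρ : YoungDiagram} {m : MonomialOrder (Fin (N + 1))}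
  {e : Fin (N + 1) ≃ Fin (N + 1)}

theorem exists_mem_support_of_rename {f : MvPolynomial (Fin (N + 1)) K} {u : Fin (N + 1) →₀ ℕ}
    (hu : u ∈ (rename e.symm f).support) : ∃ w ∈ f.support, ∀ i, w (e i) = u i := by
  classical
  rw [support_rename_of_injective e.symm.injective, mem_image] at hu
  obtain ⟨w, hw, rfl⟩ := hu
  refine ⟨w, hw, fun i => ?_⟩
  conv_rhs => rw [← e.symm_apply_apply i]
  rw [Finsupp.mapDomain_apply e.symm.injective]

theorem IsColumnFamily.exists_degree_spechtPoly_le {C : ℕ → Finset (Fin (N + 1))}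
    (hC : IsColumnFamily l ρ C) (he : e 0 = 0) {u : Fin (N + 1) →₀ ℕ}
    (h0 : m.degree (columnsPoly K ρ C) 0 ≤ u 0)
    (hs : ∀ k : Fin N, m.degree (columnsPoly K ρ C) (e k.succ) ≤ u (e k.succ)) :
    ∃ T : LTableau (N + 1) l ρ, m.degree (T.spechtPoly K) ≤ u := by
  obtain ⟨T, rfl⟩ := hC.exists_tableau
  refine ⟨T, ?_⟩
  rw [m.degree_eq_of_associated T.associated_spechtPoly]
  intro i
  obtain ⟨j, rfl⟩ := e.surjective i
  refine Fin.cases ?_ (fun k => ?_) j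
  · rw [he]
    exact h0
  · exact hs k

theorem sum_card_filter_eq {K : Type*} [DecidableEq K] (he : e 0 = 0) {a : Fin (N + 1) → K} {a' : Fin N → K}
    (ha : ∀ k, a (e k.succ) = a' k) {b : ℕ → K} (hb : Function.Injective b) (T : Finset ℕ) :
    #{i | i ≠ 0 ∧ a i ∈ T.image b} = ∑ i ∈ T, #{k | a' k = b i} := by
  rw [card_filter_succ he]
  simp only [ha]
  rw [card_eq_sum_card_fiberwise (f := a') (t := T.image b)
    (fun k hk => by simpa using hk), sum_image hb.injOn]
  refine sum_congr rfl fun i hi => ?_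
  rw [filter_filter]
  congr 1
  ext k
  simp only [mem_filter, mem_univ, true_and, and_iff_right_iff_imp]
  intro h
  rw [h]
  exact mem_image_of_mem _ hi

theorem evalExceptZero_eq_map (he : e 0 = 0) {a : Fin (N + 1) → K} {a' : Fin N → K}
    (ha : ∀ k, a (e k.succ) = a' k) (f : MvPolynomial (Fin (N + 1)) K) :
    evalExceptZero a f = (finSuccEquiv K N (rename e.symm f)).map (eval a') := by
  have : evalExceptZero a = (Polynomial.mapAlgHom (aeval a')).comp
      ((finSuccEquiv K N).toAlgHom.comp (rename e.symm)) := by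
    refine algHom_ext fun i => ?_
    obtain ⟨j, rfl⟩ := e.surjective i
    refine Fin.cases ?_ (fun k => ?_) j
    · rw [he, evalExceptZero_X_zero]
      have h0 : e.symm 0 = 0 := by rw [← he, e.symm_apply_apply, he]
      simp [h0, finSuccEquiv_X_zero]
    · rw [evalExceptZero_X_of_ne a fun h => Fin.succ_ne_zero k (e.injective (h.trans he.symm)), ha]
      simp [finSuccEquiv_X_succ]
  rw [this]
  rfl

theorem exists_eval_C_ne_zero [Infinite K] {P : Polynomial (MvPolynomial (Fin N) K)}
    (hP : P ≠ 0) : ∃ t : K, P.eval (C t) ≠ 0 := by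
  by_contra hcon
  push Not at hcon
  refine hP (Polynomial.eq_zero_of_infinite_isRoot P ?_)
  refine (Set.infinite_range_of_injective (C_injective (Fin N) K)).mono ?_
  rintro _ ⟨t, rfl⟩
  exact hcon t

theorem exists_mem_support_coeff_of_eval {P : Polynomial (MvPolynomial (Fin N) K)} {t : K}
    {u : Fin N →₀ ℕ} (hu : u ∈ (P.eval (C t)).support) : ∃ i, u ∈ (P.coeff i).support := by
  rw [mem_support_iff, Polynomial.eval_eq_sum, Polynomial.sum, coeff_sum] at hu
  obtain ⟨i, -, hi⟩ := exists_ne_zero_of_sum_ne_zero hu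
  refine ⟨i, mem_support_iff.mpr fun h => hi ?_⟩
  rw [← C_pow, mul_comm, coeff_C_mul, h, mul_zero]

theorem exists_injective_nat_apply_zero {K : Type*} [Infinite K] (t : K) :
    ∃ b : ℕ → K, Function.Injective b ∧ b 0 = t := by
  classical
  let s := Infinite.natEmbedding K
  exact ⟨Equiv.swap (s 0) t ∘ s, (Equiv.injective _).comp s.injective, by simp⟩

variable [Infinite K]

/-- Freezing variable `0` at `t` and counting `t` with multiplicity `l` makes the word start from a
single row of length `l`, which holds the copies of `0`. The exponent of variable `0` in `u` is not
controlled and need not be: its leading exponent in the tableau is zero. -/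
theorem exists_degree_le_of_isSmallestVar (hm : IsSmallestVar m 0)
    {f : MvPolynomial (Fin (N + 1)) K} (hf : f ∈ spechtIdeal K (N + 1) l μ) (hf0 : f ≠ 0) :
    ∃ u ∈ f.support, ∃ ρ : YoungDiagram, ρ.card = N + l ∧ l ≤ ρ.rowLen 0 ∧ Dominates μ ρ ∧
      ∃ T : LTableau (N + 1) l ρ, m.degree (T.spechtPoly K) ≤ u := by
  classical
  obtain ⟨e, he, hlt⟩ := exists_equiv_sorting m
  have hP : finSuccEquiv K N (rename e.symm f) ≠ 0 :=
    (EmbeddingLike.map_ne_zero_iff).mpr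
      ((map_ne_zero_iff _ (rename_injective _ e.symm.injective)).mpr hf0)
  obtain ⟨t, ht⟩ := exists_eval_C_ne_zero hP
  obtain ⟨b, hb, hbt⟩ := exists_injective_nat_apply_zero t
  let c : ℕ → ℕ := fun i => if i = 0 then l else 0
  have hc0 : c 0 = l := rfl
  have hcs : ∀ i, c (i + 1) = 0 := fun _ => rfl
  have hc : Antitone c := antitone_nat_of_succ_le fun i => by
    rw [hcs]
    exact Nat.zero_le _
  obtain ⟨u', hu', r, a', b', hb', ha', hr, hlat, hcount⟩ :=
    exists_latticeWord_eval_ne_zero hc (M := fun v => if v = t then l else 0) hb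
      (fun i => by simp only [c, ← hbt, hb.eq_iff]) _ ht
  obtain ⟨d, hd⟩ := exists_mem_support_coeff_of_eval hu'
  obtain ⟨u, hu, hue⟩ := exists_mem_support_of_rename (mem_support_coeff_finSuccEquiv.mp hd)
  let a : Fin (N + 1) → K := (Fin.cons t a' : Fin (N + 1) → K) ∘ e.symm
  have haS : ∀ k, a (e k.succ) = a' k := fun k => by simp [a]
  have ha0 : a 0 = t := by
    rw [← he]
    simp [a]
  have haf : eval a f ≠ 0 := by
    rw [← eval_rename, eval_eq_eval_mv_eval']
    convert ha' using 1
    rw [Polynomial.eval_map, ← Polynomial.eval₂_at_apply, eval_C]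
  obtain ⟨C, hC, hinj⟩ := exists_columnFamily_injOn_of_eval_ne_zero hf haf
  obtain ⟨B, hB0, hB⟩ := exists_wordShape_eq_zero hc (hcs 0) r
  obtain ⟨ρ, hρ⟩ := YoungDiagram.exists_rowLen_eq _ hlat.antitone_wordShape hB
  have hcard : ρ.card = N + l := by
    rw [ρ.card_eq_sum_rowLen ((hρ B).trans hB), sum_congr rfl fun i _ => hρ i,
      sum_wordShape (hlat.lt_of_wordShape_eq_zero hB), add_comm]
    congr 1
    simp only [c]
    rw [sum_ite_eq' (range B) 0, if_pos (mem_range.mpr hB0)]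
  have hcol : ∀ x, ρ.colLen x = #{k : Fin N | wordCol c r k = x} +
      if x ∈ range l then 1 else 0 := by
    intro x
    rw [ρ.colLen_eq_card_filter ((hρ B).trans hB)]
    simp only [hρ]
    rw [← hlat.card_wordCol_eq hB, add_comm]
    congr 1
    have : ({i ∈ range B | x < c i} : Finset ℕ) = if x < l then {0} else ∅ := by
      ext i
      rcases i with _ | i
      · by_cases h : x < l <;> simp [h, hc0, hB0]
      · by_cases h : x < l <;> simp [h, hcs]
    rw [this]
    by_cases h : x < l <;> simp [h]
  have hfam := isColumnFamily_wordColumns he hcol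
  rw [card_range] at hfam
  refine ⟨u, hu, ρ, hcard, ?_, ?_, hfam.exists_degree_spechtPoly_le he ?_ fun k => ?_⟩
  · rw [hρ]
    exact Nat.le_add_right _ _
  · intro j
    have := hC.card_add_le_of_injOn hinj ((range j).image b')
    rw [sum_card_filter_eq he haS hb', card_image_of_injective _ hb', card_range, ha0] at this
    refine le_trans (le_of_eq ?_) this
    simp only [hρ, ← hcount]
    rw [sum_add_distrib, add_comm]
    congr 1
    rw [← sum_image (f := fun v => if v = t then l else 0) hb'.injOn, sum_ite_eq']
  · refine (degree_wordColumns_zero_le he ρ).trans ?_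
    rw [sum_eq_zero]
    · exact Nat.zero_le _
    · intro x _
      rw [card_eq_zero, filter_eq_empty_iff]
      exact fun k _ h => (hm (e k.succ)).not_gt h.2
  · rw [hue, Finsupp.cons_succ]
    -- Letters in row `0` lie in columns from `l` on, so a letter sharing a column with a copy of
    -- `0` lies below row `0`.
    refine (degree_wordColumns_succ_le he hlt hlat ρ k fun hk _ => ⟨0, ?_, ?_⟩).trans (hr k)
    · refine Nat.pos_of_ne_zero fun h0 => ?_
      have : c (r k) ≤ wordCol c r k := Nat.le_add_right _ _
      rw [h0, hc0] at this
      rw [mem_range] at hk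
      omega
    · exact mem_range.mp hk

/-- The leading coefficient in variable `0` yields a word of shape `ν`, and the copies of `0` form a
strip around it. Being largest, a copy in row `i` costs exponent at most `i`; the total is the sum
of defects, bounded by the degree in that variable. -/
theorem exists_degree_le_of_isLargestVar (hm : IsLargestVar m 0)
    {f : MvPolynomial (Fin (N + 1)) K} (hf : f ∈ spechtIdeal K (N + 1) l μ) (hf0 : f ≠ 0) :
    ∃ u ∈ f.support, ∃ ρ : YoungDiagram, ρ.card = N + l ∧ l ≤ ρ.rowLen 0 ∧ Dominates μ ρ ∧
      ∃ T : LTableau (N + 1) l ρ, m.degree (T.spechtPoly K) ≤ u := by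
  classical
  obtain ⟨e, he, hlt⟩ := exists_equiv_sorting m
  set P := finSuccEquiv K N (rename e.symm f) with hPdef
  have hP : P ≠ 0 := (EmbeddingLike.map_ne_zero_iff).mpr
    ((map_ne_zero_iff _ (rename_injective _ e.symm.injective)).mpr hf0)
  let c : ℕ → ℕ := fun _ => 0
  have hc : Antitone c := antitone_const
  obtain ⟨b, hb, -⟩ := exists_injective_nat_apply_zero (0 : K)
  obtain ⟨u', hu', r, a', b', hb', ha', hr, hlat, hcount⟩ :=
    exists_latticeWord_eval_ne_zero hc (M := fun _ => 0) hb (fun _ => rfl) _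
      (Polynomial.leadingCoeff_ne_zero.mpr hP)
  obtain ⟨u, hu, hue⟩ := exists_mem_support_of_rename (mem_support_coeff_finSuccEquiv.mp hu')
  let a : Fin (N + 1) → K := (Fin.cons 0 a' : Fin (N + 1) → K) ∘ e.symm
  have haS : ∀ k, a (e k.succ) = a' k := fun k => by simp [a]
  have hpc : (evalExceptZero a f).coeff P.natDegree ≠ 0 := by
    rw [evalExceptZero_eq_map he haS, ← hPdef, Polynomial.coeff_map]
    exact ha'
  have hp : evalExceptZero a f ≠ 0 := fun h => hpc (by rw [h, Polynomial.coeff_zero])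
  have hpd : (evalExceptZero a f).natDegree ≤ P.natDegree := by
    rw [evalExceptZero_eq_map he haS]
    exact Polynomial.natDegree_map_le
  let ν : ℕ → ℕ := wordShape c r
  have hν : Antitone ν := hlat.antitone_wordShape
  have hcountS : ∀ T : Finset ℕ, #{i | i ≠ 0 ∧ a i ∈ T.image b'} = ∑ i ∈ T, ν i := fun T => by
    rw [sum_card_filter_eq he haS hb']
    refine sum_congr rfl fun i _ => ?_
    rw [← zero_add (#_)]
    exact hcount i
  obtain ⟨J, -, hJ⟩ := exists_wordShape_eq_zero hc rfl r
  -- For each `j` the pigeonhole bound is used with the values of the `j + 1` rows in the bracket of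
  -- `stripDefect`, a set containing `b' k`.
  have hD : ∀ k, (Polynomial.X - Polynomial.C (b' k)) ^ stripDefect ν μ.rowLen l J k ∣
      evalExceptZero a f := by
    intro k
    refine pow_dvd_evalExceptZero hf a (b' k) _ fun C hC hinj => Finset.sup_le fun j _ => ?_
    rw [Nat.sub_le_iff_le_add']
    split_ifs with hkj
    · have := hC.card_add_le_add hinj ((range (j + 1)).image b') (v := b' k)
        (mem_image_of_mem _ (mem_range.mpr (by omega)))
      rwa [hcountS, card_image_of_injective _ hb', card_range] at this
    · have := hC.card_add_le_add hinj ((insert k (range j)).image b') (v := b' k)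
        (mem_image_of_mem _ (mem_insert_self _ _))
      rwa [hcountS, card_image_of_injective _ hb', card_insert_of_notMem (by rw [mem_range]; omega),
        sum_insert (by rw [mem_range]; omega), card_range, add_comm (ν k)] at this
  have hDsum : ∑ k ∈ range J, stripDefect ν μ.rowLen l J k ≤ P.natDegree :=
    (sum_le_natDegree_of_pow_dvd hp hb' fun k _ => hD k).trans hpd
  obtain ⟨C, hC, hC0⟩ := exists_columnFamily_map_ne_zero (evalExceptZero a).toRingHom hf hp
  have hinj := hC.injOn_of_evalExceptZero_ne_zero hC0
  have h1 : ∀ j, ∑ i ∈ range j, ν i ≤ ∑ i ∈ range j, μ.rowLen i := fun j => by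
    have := hC.card_le hinj ((range j).image b')
    rwa [hcountS, card_image_of_injective _ hb', card_range] at this
  have h2 : ∀ j, ∑ i ∈ range j, ν i + l ≤ ∑ i ∈ range (j + 1), μ.rowLen i := fun j => by
    have := hC.card_add_le_succ hinj ((range j).image b')
    rwa [hcountS, card_image_of_injective _ hb', card_range] at this
  obtain ⟨ρ', hνρ, hρν, hdom, hsize, hrows⟩ := exists_horizontalStrip hν hJ h1 h2
  have hν1 : ν (J + 1) = 0 := Nat.le_zero.mp ((hν (Nat.le_add_right J 1)).trans hJ.le)
  have hρ1 : ρ' (J + 1) = 0 := Nat.le_zero.mp ((hρν J).trans hJ.le)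
  obtain ⟨ρ, hρ⟩ := YoungDiagram.exists_rowLen_eq ρ'
    (antitone_nat_of_succ_le fun i => (hρν i).trans (hνρ i)) hρ1
  have hsep : ∀ i j, i < j → ρ' j ≤ ν i := by
    intro i j hij
    obtain ⟨j, rfl⟩ : ∃ j', j = j' + 1 := ⟨j - 1, by omega⟩
    exact (hρν j).trans (hν (by omega))
  let Z : Finset ℕ := (range (J + 1)).biUnion fun i => Ico (ν i) (ρ' i)
  have hdisj : Set.PairwiseDisjoint (range (J + 1) : Set ℕ) fun i => Ico (ν i) (ρ' i) := by
    intro i _ j _ hij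
    rw [Function.onFun, disjoint_left]
    intro x hx hx'
    rw [mem_Ico] at hx hx'
    rcases lt_or_gt_of_ne hij with h | h
    · have := hsep i j h
      omega
    · have := hsep j i h
      omega
  have hZ : #Z = l := by
    rw [card_biUnion hdisj, ← hsize]
    exact sum_congr rfl fun i _ => Nat.card_Ico _ _
  have hword : ∀ x, #{k : Fin N | wordCol c r k = x} = #{i ∈ range (J + 1) | x < ν i} := by
    intro x
    rw [← hlat.card_wordCol_eq hν1 x]
    simp [c]
  have hcol : ∀ x, ρ.colLen x = #{k : Fin N | wordCol c r k = x} + if x ∈ Z then 1 else 0 := by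
    intro x
    rw [ρ.colLen_eq_card_filter ((hρ _).trans hρ1), hword]
    simp only [hρ]
    have hone : #{i ∈ range (J + 1) | x ∈ Ico (ν i) (ρ' i)} = if x ∈ Z then 1 else 0 := by
      split_ifs with hx
      · obtain ⟨i, hi, hxi⟩ := mem_biUnion.mp hx
        rw [card_eq_one]
        refine ⟨i, ?_⟩
        ext j
        rw [mem_filter, mem_singleton]
        constructor
        · rintro ⟨hj, hxj⟩
          by_contra hne
          exact (disjoint_left.mp (hdisj (mem_coe.mpr hj) (mem_coe.mpr hi) hne)) hxj hxi
        · rintro rfl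
          exact ⟨hi, hxi⟩
      · rw [card_eq_zero, filter_eq_empty_iff]
        exact fun i hi hxi => hx (mem_biUnion.mpr ⟨i, hi, hxi⟩)
    rw [← hone, ← card_union_of_disjoint]
    · congr 1
      ext i
      have := hνρ i
      simp only [mem_filter, mem_union, mem_Ico]
      by_cases hi : i ∈ range (J + 1)
      · simp only [hi, true_and]
        omega
      · simp [hi]
    · rw [disjoint_left]
      intro i hi hi'
      have h3 := (mem_filter.mp hi).2
      have h4 := mem_Ico.mp (mem_filter.mp hi').2
      omega
  have hfam := isColumnFamily_wordColumns he hcol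
  rw [hZ] at hfam
  refine ⟨u, hu, ρ, ?_, ?_, ?_, hfam.exists_degree_spechtPoly_le he ?_ fun k => ?_⟩
  · rw [ρ.card_eq_sum_rowLen ((hρ _).trans hρ1), ← hsize]
    have h3 := sum_wordShape (c := c) (hlat.lt_of_wordShape_eq_zero hν1)
    rw [show ∑ i ∈ range (J + 1), c i = 0 from sum_const_zero, zero_add] at h3
    conv_rhs => rw [← h3]
    rw [← sum_add_distrib]
    refine sum_congr rfl fun i _ => ?_
    rw [hρ]
    exact (Nat.add_sub_of_le (hνρ i)).symm
  · rw [← hZ, hρ]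
    conv_rhs => rw [← card_range (ρ' 0)]
    refine card_le_card fun x hx => ?_
    obtain ⟨i, -, hxi⟩ := mem_biUnion.mp hx
    rw [mem_Ico] at hxi
    rw [mem_range]
    rcases i with _ | i
    · exact hxi.2
    · have := hsep 0 (i + 1) (by omega)
      have := hνρ 0
      omega
  · intro k
    simp only [hρ]
    exact hdom k
  · refine (degree_wordColumns_zero_le he ρ).trans ?_
    have hu0 : u 0 = P.natDegree := by
      have := hue 0
      rwa [he, Finsupp.cons_zero] at this
    rw [hu0]
    refine le_trans ?_ (hrows.le.trans hDsum)
    rw [sum_biUnion hdisj]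
    refine sum_le_sum fun i _ => ?_
    -- A column `x ≥ ν i` meets only rows of `ν` with index less than `i`, hence contains at most
    -- `i` letters.
    refine (sum_le_card_nsmul _ _ i fun x hx => ?_).trans (by rw [Nat.card_Ico, smul_eq_mul])
    rw [mem_Ico] at hx
    calc _ ≤ #{k : Fin N | wordCol c r k = x} :=
          card_le_card (monotone_filter_right _ fun k _ h => h.1)
      _ = #{j ∈ range (J + 1) | x < ν j} := hword x
      _ ≤ #(range i) := by
        refine card_le_card fun j hj => ?_
        rw [mem_range]
        by_contra hij
        have h3 := hν (not_lt.mp hij)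
        have h4 := (mem_filter.mp hj).2
        omega
      _ = i := card_range i
  · rw [hue, Finsupp.cons_succ]
    exact (degree_wordColumns_succ_le he hlt hlat ρ k fun _ h =>
      absurd h (hm (e k.succ)).not_gt).trans (hr k)

end InitialMonomials

/-! ### Finiteness of the set of Specht polynomials. -/

section Finiteness

theorem finite_partitionsGE (n l : ℕ) : (partitionsGE n l).Finite := by
  refine Set.Finite.of_finite_image (f := YoungDiagram.cells)
    ((range (n + l) ×ˢ range (n + l)).powerset.finite_toSet.subset ?_)
    fun ρ _ μ _ h => YoungDiagram.ext h
  rintro _ ⟨ρ, ⟨hcard, -⟩, rfl⟩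
  rw [mem_coe, mem_powerset]
  rintro ⟨i, j⟩ hc
  have hij := (YoungDiagram.mem_cells _).mp hc
  have hsub : range (i + 1) ×ˢ {j} ∪ {i} ×ˢ range (j + 1) ⊆ ρ.cells := by
    rintro ⟨i', j'⟩ h
    rw [YoungDiagram.mem_cells]
    simp only [mem_union, mem_product, mem_range, mem_singleton] at h
    exact ρ.up_left_mem (i2 := i) (j2 := j) (by omega) (by omega) hij
  have h1 := card_le_card (subset_union_left.trans hsub)
  have h2 := card_le_card (subset_union_right.trans hsub)
  rw [card_product, card_range, card_singleton] at h1 h2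
  change _ ≤ ρ.card at h1 h2
  rw [mem_product, mem_range, mem_range]
  constructor <;> omega

instance LTableau.finite {n l : ℕ} [NeZero n] {ρ : YoungDiagram} : Finite (LTableau n l ρ) := by
  refine Finite.of_injective LTableau.entry fun T T' h => ?_
  cases T
  cases T'
  cases h
  rfl

end Finiteness

end

theorem mainTheorem6 {K : Type*} [Field K] [Infinite K] (n l : ℕ) [NeZero n] (hl : 1 ≤ l)
    (μ : YoungDiagram) (hμ : μ ∈ partitionsGE n l) (m : MonomialOrder (Fin n))
    (hm : IsSmallestVar m 0 ∨ IsLargestVar m 0) :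
    IsGroebnerBasis m
      {f : MvPolynomial (Fin n) K |
        ∃ ρ ∈ partitionsGE n l, Dominates μ ρ ∧ ∃ T : LTableau n l ρ, f = T.spechtPoly K}
      (spechtIdeal K n l μ) := by
  refine isGroebnerBasis_of_exists_mem_support m ?_ ?_ ?_ ?_
  · refine ((finite_partitionsGE n l).biUnion fun ρ _ =>
      Set.finite_range fun T : LTableau n l ρ => T.spechtPoly K).subset ?_
    rintro _ ⟨ρ, hρ, -, T, rfl⟩
    exact Set.mem_biUnion hρ ⟨T, rfl⟩
  · rintro _ ⟨ρ, -, -, T, rfl⟩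
    exact T.spechtPoly_ne_zero
  · rintro _ ⟨ρ, hρ, hdom, T, rfl⟩
    refine spechtIdeal_le_of_dominates ?_ hdom (Ideal.subset_span ⟨T, rfl⟩)
    have h1 := hρ.1
    have h2 := hμ.1
    omega
  · intro f hf hf0
    obtain ⟨N, rfl⟩ : ∃ N, n = N + 1 := ⟨n - 1, by have := NeZero.pos n; omega⟩
    obtain ⟨u, hu, ρ, hcard, hrow, hdom, T, hT⟩ :=
      hm.elim (fun h => exists_degree_le_of_isSmallestVar h hf hf0)
        fun h => exists_degree_le_of_isLargestVar h hf hf0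
    exact ⟨u, hu, _, ⟨ρ, ⟨by omega, hrow⟩, hdom, T, rfl⟩, hT⟩
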